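/- Let $d\in\{1,2,3\}$, let $\gamma_1,\dots,\gamma_d>0$ and $V(x)=\frac12\sum_{i=1}^d\gamma_i^2x_i^2$ on $\mathbb R^d$. For $\beta\in\mathbb R$, $\delta>0$ let $$E_{\beta,\delta}(\phi)=\int_{\mathbb R^d}\Bigl(\tfrac12|\nabla\phi|^2+V|\phi|^2+\tfrac{\beta}{2}|\phi|^4+\tfrac{\delta}{2}\bigl|\nabla|\phi|^2\bigr|^2\Bigr)\,dx,$$ considered on the set $S$ of all complex-valued $\phi\in H^1(\mathbb R^d)$ with $\int V|\phi|^2<\infty$, $\|\phi\|_{L^2}=1$ and finite energy. A nonnegative ground state is an almost everywhere nonnegative $\phi_g\in S$ with $E_{\beta,\delta}(\phi_g)=\min_{S}E_{\beta,\delta}$. For $\varepsilon>0$ put $\phi_g^\varepsilon(x)=\varepsilon^{-d/2}\phi_g(x/\varepsilon)$ and $\rho_g^\varepsilon=|\phi_g^\varepsilon|^2$. For $\delta_\infty>0$ let $$E_1(\phi)=\int\Bigl(V|\phi|^2+\tfrac12|\phi|^4\Bigr),\quad E_2(\phi)=\int\Bigl(V|\phi|^2+\tfrac12|\phi|^4+\tfrac{\delta_\infty}{2}\bigl|\nabla|\phi|^2\bigr|^2\Bigr),\quad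 E_3(\phi)=\int\Bigl(V|\phi|^2+\tfrac12\bigl|\nabla|\phi|^2\bigr|^2\Bigr),$$ each considered on the $\phi\in L^2(\mathbb R^d)$ with $\|\phi\|_{L^2}=1$ and finite energy (with $\nabla|\phi|^2$ the weak gradient where it occurs). Then each of $E_1$, $E_2$, $E_3$ has a nonnegative minimizer, and it is unique up to null sets. Let $\beta\to+\infty$ with $\delta=\delta(\beta)>0$ (or, more generally, let $(\beta,\delta)$ vary along any net with $\beta\to+\infty$ and $\delta>0$), and let $\phi_g$ be a nonnegative ground state of $E_{\beta,\delta}$ for each such pair $(\beta,\delta)$. 1. If $\delta/\beta^{\frac{4+d}{2+d}}\to0$ and $\varepsilon=\beta^{-\frac1{2+d}}$, then $\rho_g^\varepsilon\to\rho_\infty=|\phi_\infty|^2$ in $L^2(\mathbb R^d)$, where $\phi_\infty$ is the unique nonnegative minimizer of $E_1$. Moreover $\rho_\infty=\max\{\mu-V,0\}$ almost everywhere, with $\mu=E_1(\phi_\infty)+\frac12\|\rho_\infty\|_{L^2}^2$. 2. If $\delta/\beta^{\frac{4+d}{2+d}}\to\delta_\infty>0$ and $\varepsilon=\beta^{-\frac1{2+d}}$,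 then $\rho_g^\varepsilon\to|\phi_\infty|^2$ in $H^1(\mathbb R^d)$, where $\phi_\infty$ is the unique nonnegative minimizer of $E_2$. 3. If $\delta/\beta^{\frac{4+d}{2+d}}\to+\infty$ and $\varepsilon=\delta^{-\frac1{4+d}}$, then $\rho_g^\varepsilon\to|\phi_\infty|^2$ in $H^1(\mathbb R^d)$, where $\phi_\infty$ is the unique nonnegative minimizer of $E_3$. -/

import Mathlib

open MeasureTheory Filter Topology
open scoped ContDiff ENNReal

noncomputable section

namespace BEC

/-- The space `ℝ^d` with its Euclidean norm and Lebesgue measure. -/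
abbrev Space (d : ℕ) : Type := EuclideanSpace ℝ (Fin d)

section Weak

variable {d : ℕ} {F : Type*} [NormedAddCommGroup F] [NormedSpace ℝ F]

/-- `g` is the weak partial derivative `∂_i f` on `ℝ^d`: both are locally integrable and
`∫ (∂_i η) f = - ∫ η g` for every real test function `η ∈ C_c^∞(ℝ^d)`. -/
def HasWeakPartial (i : Fin d) (f g : Space d → F) : Prop :=
  LocallyIntegrable f volume ∧ LocallyIntegrable g volume ∧
    ∀ η : Space d → ℝ, ContDiff ℝ ∞ η → HasCompactSupport η →
      ∫ x, (fderiv ℝ η x (EuclideanSpace.single i 1)) • f x = - ∫ x, η x • g x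

open Classical in
/-- The weak partial derivative `∂_i f` (unique up to null sets when it exists; `0` otherwise). -/
def weakPartial (i : Fin d) (f : Space d → F) : Space d → F :=
  if h : ∃ g, HasWeakPartial i f g then h.choose else 0

/-- `|∇f(x)|² = ∑_i |∂_i f(x)|²`, with weak derivatives. -/
def gradSq (f : Space d → F) (x : Space d) : ℝ :=
  ∑ i, ‖weakPartial i f x‖ ^ 2

/-- `f` has a weak gradient, and this gradient is in `L²`. -/
def HasL2WeakGrad (f : Space d → F) : Prop :=
  ∀ i, ∃ g, HasWeakPartial i f g ∧ MemLp g 2 volume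

/-- `f ∈ H¹(ℝ^d)`. -/
def MemH1 (f : Space d → F) : Prop :=
  MemLp f 2 volume ∧ HasL2WeakGrad f

/-- `f_i → f` in `H¹(ℝ^d)` along the filter `l`: the functions are in `H¹` (the `f_i` from some
point on) and `f_i - f` and all `∂_k f_i - ∂_k f` tend to `0` in `L²`. -/
def TendstoInH1 {ι : Type*} (f : ι → Space d → F) (l : Filter ι) (f₀ : Space d → F) : Prop :=
  (∀ᶠ i in l, MemH1 (f i)) ∧ MemH1 f₀ ∧
    Tendsto (fun i => eLpNorm (f i - f₀) 2 volume) l (𝓝 0) ∧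
    ∀ k, Tendsto (fun i => eLpNorm (weakPartial k (f i) - weakPartial k f₀) 2 volume) l (𝓝 0)

/-- `f_i → f` in `L²(ℝ^d)` along the filter `l`. -/
def TendstoInL2 {ι : Type*} (f : ι → Space d → F) (l : Filter ι) (f₀ : Space d → F) : Prop :=
  (∀ᶠ i in l, MemLp (f i) 2 volume) ∧ MemLp f₀ 2 volume ∧
    Tendsto (fun i => eLpNorm (f i - f₀) 2 volume) l (𝓝 0)

end Weak

variable {d : ℕ}

/-- The harmonic potential `V(x) = ½ ∑_i γ_i² x_i²`. -/
def harmonicPotential (γ : Fin d → ℝ) (x : Space d) : ℝ :=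
  (1 / 2) * ∑ i, γ i ^ 2 * x i ^ 2

/-- The density `ρ = |φ|²`. -/
def density (φ : Space d → ℂ) (x : Space d) : ℝ := ‖φ x‖ ^ 2

/-- The energy
`E(φ) = ∫ (½|∇φ|² + V|φ|² + (β/2)|φ|⁴ + (δ/2)|∇|φ|²|²)`. -/
def energy (V : Space d → ℝ) (β δ : ℝ) (φ : Space d → ℂ) : ℝ :=
  ∫ x, ((1 / 2) * gradSq φ x + V x * density φ x + (β / 2) * density φ x ^ 2
    + (δ / 2) * gradSq (density φ) x)

/-- `E₁(φ) = ∫ (V|φ|² + ½|φ|⁴)`. -/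
def energy₁ (V : Space d → ℝ) (φ : Space d → ℂ) : ℝ :=
  ∫ x, (V x * density φ x + (1 / 2) * density φ x ^ 2)

/-- `E₂(φ) = ∫ (V|φ|² + ½|φ|⁴ + (δ∞/2)|∇|φ|²|²)`. -/
def energy₂ (V : Space d → ℝ) (δinf : ℝ) (φ : Space d → ℂ) : ℝ :=
  ∫ x, (V x * density φ x + (1 / 2) * density φ x ^ 2 + (δinf / 2) * gradSq (density φ) x)

/-- `E₃(φ) = ∫ (V|φ|² + ½|∇|φ|²|²)`. -/
def energy₃ (V : Space d → ℝ) (φ : Space d → ℂ) : ℝ :=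
  ∫ x, (V x * density φ x + (1 / 2) * gradSq (density φ) x)

/-- `φ ∈ L²`, `‖φ‖ = 1`, and `∫ V|φ|² < ∞`. -/
def IsTrappedState (V : Space d → ℝ) (φ : Space d → ℂ) : Prop :=
  MemLp φ 2 volume ∧ ∫ x, density φ x = 1 ∧ Integrable (fun x => V x * density φ x) volume

/-- The set `S` of normalized states in `X = {φ ∈ H¹ : ∫ V|φ|² < ∞}` of finite energy (for
`δ > 0`), i.e. with `|φ|² ∈ L²` and `∇|φ|² ∈ L²`. -/
def stateSet (V : Space d → ℝ) : Set (Space d → ℂ) :=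
  {φ | IsTrappedState V φ ∧ MemH1 φ ∧ MemLp (density φ) 2 volume ∧ HasL2WeakGrad (density φ)}

/-- Normalized states with finite energy `E₁`. -/
def stateSet₁ (V : Space d → ℝ) : Set (Space d → ℂ) :=
  {φ | IsTrappedState V φ ∧ MemLp (density φ) 2 volume}

/-- Normalized states with finite energy `E₂` (for `δ∞ > 0`). -/
def stateSet₂ (V : Space d → ℝ) : Set (Space d → ℂ) :=
  {φ | IsTrappedState V φ ∧ MemLp (density φ) 2 volume ∧ HasL2WeakGrad (density φ)}

/-- Normalized states with finite energy `E₃`. -/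
def stateSet₃ (V : Space d → ℝ) : Set (Space d → ℂ) :=
  {φ | IsTrappedState V φ ∧ HasL2WeakGrad (density φ)}

/-- `φ` is real and nonnegative almost everywhere, belongs to `S`, and minimizes `E` over `S`. -/
def IsNonnegMinimizer (E : (Space d → ℂ) → ℝ) (S : Set (Space d → ℂ)) (φ : Space d → ℂ) : Prop :=
  φ ∈ S ∧ IsMinOn E S φ ∧ ∀ᵐ x, 0 ≤ (φ x).re ∧ (φ x).im = 0

/-- `φ` is the unique (up to null sets) nonnegative minimizer of `E` over `S`. -/
def IsUniqueNonnegMinimizer (E : (Space d → ℂ) → ℝ) (S : Set (Space d → ℂ))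
    (φ : Space d → ℂ) : Prop :=
  IsNonnegMinimizer E S φ ∧ ∀ ψ, IsNonnegMinimizer E S ψ → ψ =ᵐ[volume] φ

/-- The rescaled function `φ^ε(x) = ε^{-d/2} φ(x/ε)`. -/
def rescale (ε : ℝ) (φ : Space d → ℂ) (x : Space d) : ℂ :=
  (ε ^ (-(d : ℝ) / 2)) • φ (ε⁻¹ • x)

end BEC

end

open BEC

namespace BEC

/-! ### Calculus of weak partial derivatives -/

section WeakDerivative

variable {d : ℕ} {F : Type*} [NormedAddCommGroup F] [NormedSpace ℝ F] {i : Fin d}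
  {f f' g g' : Space d → F}

/-! After dilation the problem becomes one about densities. For `ρ = |φ^ε|²`, the energy times `ε²`
equals `(ε⁴/2)∫|∇φ^ε|²` plus `∫Vρ + (b/2)∫ρ² + (c/2)∫|∇ρ|²`, where `b = β ε^(d+2)` and `c = δ
ε^(d+4)` (`rescale_mem_stateSet`). The choice of `ε` makes `b` or `c` equal to `1`, the other
coefficient converges, and the kinetic weight `ε⁴` tends to `0`. The limit functional is the density
part alone, a linear term plus nonnegative quadratic terms on a convex set.

The rescaled ground states are near minimizers of the limit functional. For the lower bound the
kinetic term is dropped. For the upper bound a trial state is needed, but the square root of the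
limit density need not be in `H¹`. The density is therefore convolved with a positive kernel whose
gradient is dominated by the kernel itself: the square root of the result is in `H¹`, neither `∫ρ²`
nor `∫|∇ρ|²` grows, and `∫Vρ` grows only by the kernel's own potential energy, which is as small as
desired (`IsTrappedDensity.exists_mem_stateSet`).

Near minimizers are close to each other. By the parallelogram identity the midpoint of two of them
would otherwise have too little energy, so their gradients are close in `L²`; a Nash inequality and
the common mass `1` then give `L²` closeness even when `b = 0` (`near_minimizers_close`). This one
fact yields existence (minimizing sequences are Cauchy, and the trap prevents loss of mass),
uniqueness and `H¹` convergence. Without a gradient term, the explicit Thomas–Fermi profile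
satisfies a quadratic lower bound that plays the same role (`densityEnergy_thomasFermi_add_le`). -/

theorem continuous_fderiv_single {η : Space d → ℝ} (hη : ContDiff ℝ ∞ η) (i : Fin d) :
    Continuous fun x => fderiv ℝ η x (EuclideanSpace.single i 1) :=
  (hη.continuous_fderiv (by simp)).clm_apply continuous_const

theorem hasCompactSupport_fderiv_single {η : Space d → ℝ} (hη : HasCompactSupport η) (i : Fin d) :
    HasCompactSupport fun x => fderiv ℝ η x (EuclideanSpace.single i 1) :=
  hη.fderiv_apply ℝ _

theorem HasWeakPartial.ae_eq [CompleteSpace F] (h : HasWeakPartial i f g)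
    (h' : HasWeakPartial i f g') : g =ᵐ[volume] g' := by
  have key : ∀ᵐ x ∂(volume : Measure (Space d)), (g - g') x = 0 := by
    refine ae_eq_zero_of_integral_contDiff_smul_eq_zero (h.2.1.sub h'.2.1) fun η hη hc => ?_
    have h1 := h.2.1.integrable_smul_left_of_hasCompactSupport hη.continuous hc
    have h2 := h'.2.1.integrable_smul_left_of_hasCompactSupport hη.continuous hc
    simp only [Pi.sub_apply, smul_sub]
    rw [integral_sub h1 h2, sub_eq_zero, ← neg_inj, ← h.2.2 η hη hc, h'.2.2 η hη hc]
  filter_upwards [key] with x hx using sub_eq_zero.mp hx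

theorem HasWeakPartial.congr (h : HasWeakPartial i f g) (hf : f =ᵐ[volume] f')
    (hg : g =ᵐ[volume] g') : HasWeakPartial i f' g' := by
  refine ⟨h.1.congr hf, h.2.1.congr hg, fun η hη hc => ?_⟩
  rw [← integral_congr_ae (f := fun x => (fderiv ℝ η x (EuclideanSpace.single i 1)) • f x),
    h.2.2 η hη hc, integral_congr_ae]
  · filter_upwards [hg] with x hx
    rw [hx]
  · filter_upwards [hf] with x hx
    rw [hx]

theorem HasWeakPartial.weakPartial_ae_eq [CompleteSpace F] (h : HasWeakPartial i f g) :
    weakPartial i f =ᵐ[volume] g := by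
  have hex : ∃ g, HasWeakPartial i f g := ⟨g, h⟩
  have : HasWeakPartial i f (weakPartial i f) := by
    rw [weakPartial, dif_pos hex]
    exact hex.choose_spec
  exact this.ae_eq h

theorem HasL2WeakGrad.hasWeakPartial (h : HasL2WeakGrad f) (i : Fin d) :
    HasWeakPartial i f (weakPartial i f) := by
  obtain ⟨g, hg, -⟩ := h i
  have hex : ∃ g, HasWeakPartial i f g := ⟨g, hg⟩
  rw [weakPartial, dif_pos hex]
  exact hex.choose_spec

theorem HasL2WeakGrad.memLp [CompleteSpace F] (h : HasL2WeakGrad f) (i : Fin d) :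
    MemLp (weakPartial i f) 2 volume := by
  obtain ⟨g, hg, hg2⟩ := h i
  exact hg2.ae_eq hg.weakPartial_ae_eq.symm

theorem HasWeakPartial.add (h : HasWeakPartial i f g) (h' : HasWeakPartial i f' g') :
    HasWeakPartial i (f + f') (g + g') := by
  refine ⟨h.1.add h'.1, h.2.1.add h'.2.1, fun η hη hc => ?_⟩
  have hc1 := continuous_fderiv_single hη i
  have hc2 := hasCompactSupport_fderiv_single hc i
  simp only [Pi.add_apply, smul_add]
  rw [integral_add (h.1.integrable_smul_left_of_hasCompactSupport hc1 hc2)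
      (h'.1.integrable_smul_left_of_hasCompactSupport hc1 hc2),
    integral_add (h.2.1.integrable_smul_left_of_hasCompactSupport hη.continuous hc)
      (h'.2.1.integrable_smul_left_of_hasCompactSupport hη.continuous hc),
    h.2.2 η hη hc, h'.2.2 η hη hc, neg_add]

theorem HasWeakPartial.const_smul (h : HasWeakPartial i f g) (c : ℝ) :
    HasWeakPartial i (c • f) (c • g) := by
  refine ⟨h.1.smul c, h.2.1.smul c, fun η hη hc => ?_⟩
  simp only [Pi.smul_apply]
  simp_rw [smul_comm _ c]
  rw [integral_smul, integral_smul, h.2.2 η hη hc, smul_neg]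

theorem HasWeakPartial.sub (h : HasWeakPartial i f g) (h' : HasWeakPartial i f' g') :
    HasWeakPartial i (f - f') (g - g') := by
  simpa [sub_eq_add_neg] using h.add (h'.const_smul (-1))

/-- Testing a weak derivative against a translated test function. -/
theorem HasWeakPartial.integral_translate (h : HasWeakPartial i f g) {η : Space d → ℝ}
    (hη : ContDiff ℝ ∞ η) (hc : HasCompactSupport η) (y : Space d) :
    ∫ x, (fderiv ℝ η (x + y) (EuclideanSpace.single i 1)) • f x = - ∫ x, η (x + y) • g x := by
  have := h.2.2 (fun x => η (x + y)) (hη.comp (contDiff_id.add contDiff_const))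
    (hc.comp_homeomorph (Homeomorph.addRight y))
  simpa [fderiv_comp_add_right] using this

/-- Dilation of a weakly differentiable function. -/
theorem HasWeakPartial.comp_smul (h : HasWeakPartial i f g) {c : ℝ} (hc : c ≠ 0)
    (hf : LocallyIntegrable (fun x => f (c • x)) volume)
    (hg : LocallyIntegrable (fun x => g (c • x)) volume) :
    HasWeakPartial i (fun x => f (c • x)) (fun x => c • g (c • x)) := by
  refine ⟨hf, hg.smul c, fun η hη hcs => ?_⟩
  have key := h.2.2 (fun x => η (c⁻¹ • x)) (hη.comp (contDiff_id.const_smul c⁻¹))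
    (hcs.comp_homeomorph (Homeomorph.smulOfNeZero c⁻¹ (inv_ne_zero hc)))
  have e1 : ∀ x, fderiv ℝ (fun x => η (c⁻¹ • x)) x (EuclideanSpace.single i 1)
      = c⁻¹ * fderiv ℝ η (c⁻¹ • x) (EuclideanSpace.single i 1) := fun x => by
    rw [fderiv_comp_smul]; simp
  simp only [e1] at key
  have k1 := Measure.integral_comp_smul (volume : Measure (Space d))
    (fun x => (c⁻¹ * fderiv ℝ η (c⁻¹ • x) (EuclideanSpace.single i 1)) • f x) c
  have k2 := Measure.integral_comp_smul (volume : Measure (Space d))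
    (fun x => (η (c⁻¹ • x)) • g x) c
  simp only [smul_smul, inv_mul_cancel₀ hc, one_smul] at k1 k2
  rw [key, smul_neg, ← k2] at k1
  have k3 : ∀ x, (fderiv ℝ η x (EuclideanSpace.single i 1)) • f (c • x)
      = c • ((c⁻¹ * fderiv ℝ η x (EuclideanSpace.single i 1)) • f (c • x)) := fun x => by
    rw [smul_smul, mul_inv_cancel_left₀ hc]
  have k4 : ∀ x, η x • c • g (c • x) = c • (η x • g (c • x)) := fun x => smul_comm _ _ _
  simp_rw [k3, k4]
  rw [integral_smul, integral_smul, k1, smul_neg]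

/-- A classical derivative is a weak derivative. -/
theorem HasWeakPartial.of_differentiable (hf : Differentiable ℝ f)
    (hg : LocallyIntegrable (fun x => fderiv ℝ f x (EuclideanSpace.single i 1)) volume) :
    HasWeakPartial i f (fun x => fderiv ℝ f x (EuclideanSpace.single i 1)) := by
  refine ⟨hf.continuous.locallyIntegrable, hg, fun η hη hc => ?_⟩
  rw [integral_smul_fderiv_eq_neg_fderiv_smul_of_integrable
    (hf.continuous.locallyIntegrable.integrable_smul_left_of_hasCompactSupport
      (continuous_fderiv_single hη i) (hasCompactSupport_fderiv_single hc i))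
    (hg.integrable_smul_left_of_hasCompactSupport hη.continuous hc)
    (hf.continuous.locallyIntegrable.integrable_smul_left_of_hasCompactSupport
      hη.continuous hc)
    (fun x _ => (hη.differentiable (by simp)) x) (fun x _ => hf x), neg_neg]

end WeakDerivative

/-! ### Cauchy–Schwarz and Jensen for square integrable functions -/

section SquareIntegrable

variable {α : Type*} [MeasurableSpace α] {μ : Measure α} {f g : α → ℝ}

/-- The Cauchy–Schwarz inequality for integrals of real functions. -/
theorem sq_integral_mul_le (hf : MemLp f 2 μ) (hg : MemLp g 2 μ) :
    (∫ x, f x * g x ∂μ) ^ 2 ≤ (∫ x, f x ^ 2 ∂μ) * ∫ x, g x ^ 2 ∂μ := by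
  have hfg : Integrable (fun x => f x * g x) μ := hf.integrable_mul hg
  have key : ∀ t : ℝ, 0 ≤ (∫ x, f x ^ 2 ∂μ) * (t * t) + (2 * ∫ x, f x * g x ∂μ) * t
      + ∫ x, g x ^ 2 ∂μ := fun t => by
    have h0 : 0 ≤ ∫ x, (t * f x + g x) ^ 2 ∂μ := integral_nonneg fun x => sq_nonneg _
    have h1 : ∀ x, (t * f x + g x) ^ 2 = (t * t) * f x ^ 2 + (2 * t) * (f x * g x) + g x ^ 2 :=
      fun x => by ring
    simp_rw [h1] at h0
    have h2 : Integrable (fun x => (t * t) * f x ^ 2 + (2 * t) * (f x * g x)) μ :=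
      (hf.integrable_sq.const_mul _).add (hfg.const_mul _)
    rw [integral_add h2 hg.integrable_sq,
      integral_add (hf.integrable_sq.const_mul _) (hfg.const_mul _), integral_const_mul,
      integral_const_mul] at h0
    linarith
  have := discrim_le_zero key
  rw [discrim] at this
  linarith

theorem sq_integral_le [IsProbabilityMeasure μ] (hf : MemLp f 2 μ) :
    (∫ x, f x ∂μ) ^ 2 ≤ ∫ x, f x ^ 2 ∂μ := by
  have := sq_integral_mul_le hf (memLp_const (1 : ℝ))
  simpa using this

theorem eLpNorm_two_eq (hf : MemLp f 2 μ) :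
    eLpNorm f 2 μ = ENNReal.ofReal (√(∫ x, f x ^ 2 ∂μ)) := by
  rw [hf.eLpNorm_eq_integral_rpow_norm (by simp) (by simp), Real.sqrt_eq_rpow]
  simp

theorem memLp_two_of_sq_le {F : α → ℝ} (hf : AEStronglyMeasurable f μ) (hF : Integrable F μ)
    (h : ∀ᵐ x ∂μ, f x ^ 2 ≤ F x) : MemLp f 2 μ := by
  rw [memLp_two_iff_integrable_sq hf]
  refine hF.mono' (hf.pow 2) ?_
  filter_upwards [h] with x hx
  rwa [Real.norm_of_nonneg (sq_nonneg _)]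

/-- Jensen's inequality for averages of square integrable functions. -/
theorem memLp_two_integral_prod {β : Type*} [MeasurableSpace β] {ν : Measure β} [SFinite μ]
    [IsProbabilityMeasure ν] {F : α × β → ℝ} (hF : MemLp F 2 (μ.prod ν)) :
    MemLp (fun x => ∫ y, F (x, y) ∂ν) 2 μ ∧
      ∫ x, (∫ y, F (x, y) ∂ν) ^ 2 ∂μ ≤ ∫ z, F z ^ 2 ∂(μ.prod ν) := by
  have hF2 := hF.integrable_sq
  have hle : ∀ᵐ x ∂μ, (∫ y, F (x, y) ∂ν) ^ 2 ≤ ∫ y, F (x, y) ^ 2 ∂ν := by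
    filter_upwards [hF2.prod_right_ae, hF.aestronglyMeasurable.prodMk_left] with x hx hm
    exact sq_integral_le ((memLp_two_iff_integrable_sq hm).2 hx)
  have hi := hF2.integral_prod_left
  have hmem := memLp_two_of_sq_le hF.aestronglyMeasurable.integral_prod_right' hi hle
  refine ⟨hmem, ?_⟩
  rw [integral_prod _ hF2]
  exact integral_mono_ae hmem.integrable_sq hi hle

end SquareIntegrable

/-! ### Convolution with a probability measure -/

section Averages

variable {d : ℕ} {ν : Measure (Space d)} [IsProbabilityMeasure ν] {i : Fin d}
  {f g : Space d → ℝ}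

/-- The average of the translates of `f` with respect to `ν`, that is, `f ⋆ ν`. -/
noncomputable def translateAverage (ν : Measure (Space d)) (f : Space d → ℝ) (x : Space d) : ℝ :=
  ∫ y, f (x - y) ∂ν

/-- The shear `(x, y) ↦ (x - y, y)` preserves `volume.prod ν`, since Lebesgue measure is translation
invariant. This is what makes Fubini available for averages of translates. -/
theorem integrable_translate (hf : Integrable f volume) :
    Integrable (fun z : Space d × Space d => f (z.1 - z.2)) (volume.prod ν) :=
  (measurePreserving_sub_prod volume ν).integrable_comp_of_integrable (hf.comp_fst ν)

theorem memLp_translate (hf : MemLp f 2 volume) :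
    MemLp (fun z : Space d × Space d => f (z.1 - z.2)) 2 (volume.prod ν) :=
  (hf.comp_fst ν).comp_measurePreserving (measurePreserving_sub_prod volume ν)

theorem integrable_translateAverage (hf : Integrable f volume) :
    Integrable (translateAverage ν f) volume :=
  (integrable_translate hf).integral_prod_left

theorem integral_translateAverage (hf : Integrable f volume) :
    ∫ x, translateAverage ν f x = ∫ x, f x := by
  have h := integrable_translate (ν := ν) hf
  simp only [translateAverage]
  rw [← integral_prod (fun z : Space d × Space d => f (z.1 - z.2)) h, integral_prod_symm _ h]
  simp [integral_sub_right_eq_self f]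

theorem memLp_translateAverage (hf : MemLp f 2 volume) :
    MemLp (translateAverage ν f) 2 volume :=
  (memLp_two_integral_prod (memLp_translate hf)).1

theorem integral_sq_translateAverage_le (hf : MemLp f 2 volume) :
    ∫ x, translateAverage ν f x ^ 2 ≤ ∫ x, f x ^ 2 := by
  refine (memLp_two_integral_prod (memLp_translate (ν := ν) hf)).2.trans_eq ?_
  rw [integral_prod_symm _ (memLp_translate hf).integrable_sq]
  simp [integral_sub_right_eq_self fun x => f x ^ 2]

theorem integral_abs_translateAverage_le (hf : Integrable f volume) :
    ∫ x, |translateAverage ν f x| ≤ ∫ x, |f x| := by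
  rw [← integral_translateAverage (ν := ν) hf.abs]
  exact integral_mono (integrable_translateAverage hf).abs (integrable_translateAverage hf.abs)
    fun x => abs_integral_le_integral_abs

theorem integral_mul_translateAverage {η : Space d → ℝ}
    (h : Integrable (fun z : Space d × Space d => η z.1 * f (z.1 - z.2)) (volume.prod ν)) :
    ∫ x, η x * translateAverage ν f x = ∫ y, (∫ x, η (x + y) * f x) ∂ν := by
  simp only [translateAverage, ← integral_const_mul]
  rw [integral_integral_swap h]
  congr 1
  ext y
  rw [← integral_add_right_eq_self _ y]
  simp

theorem integrable_bounded_mul_translate {η : Space d → ℝ} (hη : Continuous η)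
    (hc : HasCompactSupport η) (hf : Integrable f volume) :
    Integrable (fun z : Space d × Space d => η z.1 * f (z.1 - z.2)) (volume.prod ν) := by
  obtain ⟨C, hC⟩ := hη.bounded_above_of_compact_support hc
  exact (integrable_translate hf).bdd_mul (c := C) (hη.comp continuous_fst).aestronglyMeasurable
    (Eventually.of_forall fun z => hC z.1)

theorem integrable_mul_translate {η : Space d → ℝ} (hη : Continuous η)
    (hc : HasCompactSupport η) (hf : MemLp f 2 volume) :
    Integrable (fun z : Space d × Space d => η z.1 * f (z.1 - z.2)) (volume.prod ν) := by
  have h : MemLp η 2 volume := hη.memLp_of_hasCompactSupport hc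
  exact (h.comp_fst ν).integrable_mul (memLp_translate hf)

/-- By Fubini, testing an average of translates amounts to averaging tests against translated test
functions, and the weak derivative identity holds for each of these. -/
theorem HasWeakPartial.translateAverage (h : HasWeakPartial i f g) (hf : Integrable f volume)
    (hg : MemLp g 2 volume) :
    HasWeakPartial i (translateAverage ν f) (translateAverage ν g) := by
  refine ⟨(integrable_translateAverage hf).locallyIntegrable,
    (memLp_translateAverage hg).locallyIntegrable (by norm_num), fun η hη hc => ?_⟩
  simp only [smul_eq_mul]
  rw [integral_mul_translateAverage (integrable_bounded_mul_translate
      (continuous_fderiv_single hη i) (hasCompactSupport_fderiv_single hc i) hf),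
    integral_mul_translateAverage (integrable_mul_translate hη.continuous hc hg), ← integral_neg]
  congr 1
  ext y
  exact h.integral_translate hη hc y

end Averages

/-! ### Translation estimates and the Nash inequality -/

section Translation

variable {d : ℕ} {f : Space d → ℝ} {g : Fin d → Space d → ℝ}

theorem integral_mul_translateAverage' {ν : Measure (Space d)} [IsProbabilityMeasure ν]
    {η : Space d → ℝ} (hη : Continuous η) (hc : HasCompactSupport η) (hf : Integrable f volume) :
    ∫ x, η x * translateAverage ν f x = ∫ x, (∫ y, η (x + y) ∂ν) * f x := by
  rw [integral_mul_translateAverage (integrable_bounded_mul_translate hη hc hf)]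
  simp only [← integral_mul_const]
  rw [integral_integral_swap]
  obtain ⟨C, hC⟩ := hη.bounded_above_of_compact_support hc
  exact (hf.comp_snd ν).bdd_mul (c := C)
    (hη.comp (continuous_snd.add continuous_fst)).aestronglyMeasurable
    (Eventually.of_forall fun z => hC _)

/-- The uniform distribution on the segment from `0` to `h`. -/
noncomputable def segmentMeasure (h : Space d) : Measure (Space d) :=
  Measure.map (fun t : ℝ => t • h) (volume.restrict (Set.Ioc 0 1))

instance (h : Space d) : IsProbabilityMeasure (segmentMeasure h) := by
  have : IsProbabilityMeasure ((volume : Measure ℝ).restrict (Set.Ioc 0 1)) := ⟨by simp⟩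
  exact Measure.isProbabilityMeasure_map (by fun_prop)

theorem fderiv_apply_eq_sum (η : Space d → ℝ) (x h : Space d) :
    fderiv ℝ η x h = ∑ i, h i * fderiv ℝ η x (EuclideanSpace.single i 1) := by
  conv_lhs => rw [← (EuclideanSpace.basisFun (Fin d) ℝ).sum_repr h]
  simp [map_sum]

/-- The fundamental theorem of calculus along the segment from `x` to `x + h`, written with
`segmentMeasure` so that it can be dualized to weak derivatives. -/
theorem sub_eq_sum_integral_segmentMeasure {η : Space d → ℝ} (hη : ContDiff ℝ ∞ η)
    (x h : Space d) : η (x + h) - η x =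
      ∑ i, h i * ∫ y, fderiv ℝ η (x + y) (EuclideanSpace.single i 1) ∂(segmentMeasure h) := by
  have hcont : Continuous fun t : ℝ => fderiv ℝ η (x + t • h) :=
    (hη.continuous_fderiv (by simp)).comp (by fun_prop)
  have h1 : ∀ i, ∫ y, fderiv ℝ η (x + y) (EuclideanSpace.single i 1) ∂(segmentMeasure h)
      = ∫ t in (0 : ℝ)..1, fderiv ℝ η (x + t • h) (EuclideanSpace.single i 1) := fun i => by
    rw [segmentMeasure, integral_map (by fun_prop), intervalIntegral.integral_of_le zero_le_one]
    exact ((continuous_fderiv_single hη i).comp (by fun_prop)).aestronglyMeasurable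
  simp_rw [h1, ← intervalIntegral.integral_const_mul]
  rw [← intervalIntegral.integral_finsetSum]
  · simp_rw [← fderiv_apply_eq_sum]
    rw [intervalIntegral.integral_eq_sub_of_hasDerivAt (f := fun t : ℝ => η (x + t • h))]
    · simp
    · intro t _
      have h2 : HasDerivAt (fun t : ℝ => x + t • h) h t := by
        simpa using ((hasDerivAt_id t).smul_const h).const_add x
      exact ((hη.differentiable (by simp)) (x + t • h)).hasFDerivAt.comp_hasDerivAt t h2
    · exact (hcont.clm_apply continuous_const).intervalIntegrable _ _
  · intro i _
    exact (continuous_const.mul (hcont.clm_apply continuous_const)).intervalIntegrable _ _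

/-- Duality carries the fundamental theorem of calculus from test functions to weakly differentiable
ones: a translation is moved onto `η`, expanded along the segment, and the derivative moved back. -/
theorem translate_sub_ae_eq (hf : Integrable f volume) (hfg : ∀ i, HasWeakPartial i f (g i))
    (hg : ∀ i, MemLp (g i) 2 volume) (h : Space d) :
    (fun x => f (x - h) - f x) =ᵐ[volume]
      fun x => - ∑ i, h i * translateAverage (segmentMeasure h) (g i) x := by
  set ν := segmentMeasure h
  have hL : ∀ i, LocallyIntegrable (fun x => h i * translateAverage ν (g i) x) volume := fun i =>
    ((memLp_translateAverage (hg i)).locallyIntegrable (by norm_num)).smul (h i)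
  have hS : LocallyIntegrable (fun x => ∑ i, h i * translateAverage ν (g i) x) volume :=
    locallyIntegrable_finsetSum _ fun i _ => hL i
  have hft : Integrable (fun x => f (x - h)) volume := hf.comp_sub_right h
  have key := ae_eq_zero_of_integral_contDiff_smul_eq_zero (μ := (volume : Measure (Space d)))
    ((hft.sub hf).locallyIntegrable.add hS) fun η hη hc => by
    obtain ⟨C, hC⟩ := hη.continuous.bounded_above_of_compact_support hc
    have hb : ∀ {u : Space d → ℝ}, Integrable u volume → Integrable (fun x => η x * u x) volume :=
      fun hu => hu.bdd_mul (c := C) hη.continuous.aestronglyMeasurable (Eventually.of_forall hC)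
    have hSi := hS.integrable_smul_left_of_hasCompactSupport hη.continuous hc
    have e1 : ∫ x, η x * (f (x - h) - f x) = ∫ x, (η (x + h) - η x) * f x := by
      simp_rw [mul_sub, sub_mul]
      rw [integral_sub (hb hft) (hb hf), ← integral_add_right_eq_self _ h, integral_sub _ (hb hf)]
      · simp
      · simpa using (hb hft).comp_add_right h
    have e2 : ∫ x, (η (x + h) - η x) * f x
        = ∑ i, h i * ∫ x, fderiv ℝ η x (EuclideanSpace.single i 1) * translateAverage ν f x := by
      simp_rw [sub_eq_sum_integral_segmentMeasure hη _ h, Finset.sum_mul, mul_assoc]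
      have hint : ∀ i, Integrable (fun x => (∫ y, fderiv ℝ η (x + y) (EuclideanSpace.single i 1)
          ∂ν) * f x) volume := fun i => by
        obtain ⟨C, hC⟩ := (continuous_fderiv_single hη i).bounded_above_of_compact_support
          (hasCompactSupport_fderiv_single hc i)
        have hm : Integrable (fun z : Space d × Space d =>
            fderiv ℝ η (z.1 + z.2) (EuclideanSpace.single i 1) * f z.1) (volume.prod ν) :=
          (hf.comp_fst ν).bdd_mul (c := C) ((continuous_fderiv_single hη i).comp
            (continuous_fst.add continuous_snd)).aestronglyMeasurable
            (Eventually.of_forall fun z => hC _)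
        simpa only [integral_mul_const] using hm.integral_prod_left
      rw [integral_finsetSum _ fun i _ => (hint i).const_mul _]
      refine Finset.sum_congr rfl fun i _ => ?_
      rw [integral_const_mul, integral_mul_translateAverage' (continuous_fderiv_single hη i)
        (hasCompactSupport_fderiv_single hc i) hf]
    have e3 : ∀ i, ∫ x, fderiv ℝ η x (EuclideanSpace.single i 1) * translateAverage ν f x
        = - ∫ x, η x * translateAverage ν (g i) x := fun i =>
      ((hfg i).translateAverage hf (hg i)).2.2 η hη hc
    have e4 : ∫ x, η x * ∑ i, h i * translateAverage ν (g i) x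
        = ∑ i, h i * ∫ x, η x * translateAverage ν (g i) x := by
      simp_rw [Finset.mul_sum]
      rw [integral_finsetSum]
      · refine Finset.sum_congr rfl fun i _ => ?_
        rw [← integral_const_mul]
        congr 1
        ext x
        ring
      · exact fun i _ => (hL i).integrable_smul_left_of_hasCompactSupport hη.continuous hc
    have hadd := integral_add (hb (hft.sub hf)) hSi
    simp only [smul_eq_mul, Pi.sub_apply] at hadd
    simp only [smul_eq_mul, Pi.add_apply, Pi.sub_apply, mul_add]
    rw [hadd, e1, e2, e4]
    simp_rw [e3]
    simp
  filter_upwards [key] with x hx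
  simp only [Pi.add_apply, Pi.sub_apply] at hx
  linarith

theorem sq_sum_mul_le (h : Space d) (a : Fin d → ℝ) :
    (∑ i, h i * a i) ^ 2 ≤ ‖h‖ ^ 2 * ∑ i, a i ^ 2 := by
  rw [EuclideanSpace.real_norm_sq_eq]
  exact Finset.sum_mul_sq_le_sq_mul_sq _ _ _

/-- Cauchy–Schwarz in the index, then the fact that averaging translates does not increase the `L²`
norm. Note that `f` itself is not assumed to be in `L²`; that will be a consequence. -/
theorem memLp_translate_sub (hf : Integrable f volume) (hfg : ∀ i, HasWeakPartial i f (g i))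
    (hg : ∀ i, MemLp (g i) 2 volume) (h : Space d) :
    MemLp (fun x => f (x - h) - f x) 2 volume ∧
      ∫ x, (f (x - h) - f x) ^ 2 ≤ ‖h‖ ^ 2 * ∑ i, ∫ x, g i x ^ 2 := by
  have hae := translate_sub_ae_eq hf hfg hg h
  set ν := segmentMeasure h
  have hA : ∀ i, MemLp (translateAverage ν (g i)) 2 volume := fun i => memLp_translateAverage (hg i)
  have hS : MemLp (fun x => - ∑ i, h i * translateAverage ν (g i) x) 2 volume :=
    (memLp_finsetSum _ fun i _ => (hA i).const_mul (h i)).neg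
  have hmem := hS.ae_eq hae.symm
  refine ⟨hmem, ?_⟩
  have hint : Integrable (fun x => ‖h‖ ^ 2 * ∑ i, translateAverage ν (g i) x ^ 2) volume :=
    (integrable_finsetSum _ fun i _ => (hA i).integrable_sq).const_mul _
  calc ∫ x, (f (x - h) - f x) ^ 2 ≤ ∫ x, ‖h‖ ^ 2 * ∑ i, translateAverage ν (g i) x ^ 2 := by
        refine integral_mono_ae hmem.integrable_sq hint ?_
        filter_upwards [hae] with x hx
        rw [hx, neg_sq]
        exact sq_sum_mul_le h _
    _ = ‖h‖ ^ 2 * ∑ i, ∫ x, translateAverage ν (g i) x ^ 2 := by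
        rw [integral_const_mul, integral_finsetSum _ fun i _ => (hA i).integrable_sq]
    _ ≤ _ := by
        exact mul_le_mul_of_nonneg_left
          (Finset.sum_le_sum fun i _ => integral_sq_translateAverage_le (hg i)) (sq_nonneg _)

/-- The error made by averaging translates, in terms of the second moment. -/
theorem memLp_sub_translateAverage {ν : Measure (Space d)} [IsProbabilityMeasure ν]
    (hν : Integrable (fun y => ‖y‖ ^ 2) ν)
    (hf : Integrable f volume) (hfg : ∀ i, HasWeakPartial i f (g i))
    (hg : ∀ i, MemLp (g i) 2 volume) :
    MemLp (fun x => translateAverage ν f x - f x) 2 volume ∧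
      ∫ x, (translateAverage ν f x - f x) ^ 2 ≤ (∫ y, ‖y‖ ^ 2 ∂ν) * ∑ i, ∫ x, g i x ^ 2 := by
  have hT := fun h => memLp_translate_sub hf hfg hg h
  have hm : AEStronglyMeasurable (fun z : Space d × Space d => f (z.1 - z.2) - f z.1)
      (volume.prod ν) :=
    (integrable_translate hf).aestronglyMeasurable.sub (hf.comp_fst ν).aestronglyMeasurable
  have hbound : Integrable (fun y => ‖y‖ ^ 2 * ∑ i, ∫ x, g i x ^ 2) ν := hν.mul_const _
  have hmono : ∀ y, ∫ x, ‖(f (x - y) - f x) ^ 2‖ ≤ ‖y‖ ^ 2 * ∑ i, ∫ x, g i x ^ 2 := fun y => by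
    simpa [Real.norm_of_nonneg (sq_nonneg _)] using (hT y).2
  -- Tonelli: the slices in `x` have integral at most a multiple of `‖y‖²`, which is `ν`-integrable.
  have hF2 : Integrable (fun z : Space d × Space d => (f (z.1 - z.2) - f z.1) ^ 2)
      (volume.prod ν) := by
    refine (integrable_prod_iff' (hm.pow 2)).2
      ⟨Eventually.of_forall fun y => (hT y).1.integrable_sq, ?_⟩
    refine hbound.mono' (hm.pow 2).norm.prod_swap.integral_prod_right' ?_
    refine Eventually.of_forall fun y => ?_
    rw [Real.norm_of_nonneg (integral_nonneg fun x => norm_nonneg _)]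
    exact hmono y
  have hmem := memLp_two_integral_prod ((memLp_two_iff_integrable_sq hm).2 hF2)
  have hae : (fun x => ∫ y, (f (x - y) - f x) ∂ν) =ᵐ[volume]
      fun x => translateAverage ν f x - f x := by
    filter_upwards [(integrable_translate (ν := ν) hf).prod_right_ae] with x hx
    rw [integral_sub hx (integrable_const _)]
    simp [translateAverage]
  refine ⟨hmem.1.ae_eq hae, ?_⟩
  calc ∫ x, (translateAverage ν f x - f x) ^ 2 = ∫ x, (∫ y, (f (x - y) - f x) ∂ν) ^ 2 := by
        refine integral_congr_ae ?_
        filter_upwards [hae] with x hx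
        rw [hx]
    _ ≤ _ := hmem.2
    _ = ∫ y, (∫ x, (f (x - y) - f x) ^ 2) ∂ν := integral_prod_symm _ hF2
    _ ≤ ∫ y, (‖y‖ ^ 2 * ∑ i, ∫ x, g i x ^ 2) ∂ν :=
        integral_mono hF2.integral_prod_right hbound fun y => (hT y).2
    _ = _ := integral_mul_const _ _

/-- A Nash type inequality. -/
theorem memLp_two_of_weak_gradient {ν : Measure (Space d)} [IsProbabilityMeasure ν]
    (hν : Integrable (fun y => ‖y‖ ^ 2) ν) {B : ℝ}
    (hB : ∀ x, |translateAverage ν f x| ≤ B * ∫ x, |f x|)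
    (hf : Integrable f volume) (hfg : ∀ i, HasWeakPartial i f (g i))
    (hg : ∀ i, MemLp (g i) 2 volume) :
    MemLp f 2 volume ∧ ∫ x, f x ^ 2 ≤ 2 * (∫ y, ‖y‖ ^ 2 ∂ν) * (∑ i, ∫ x, g i x ^ 2)
      + 2 * B * (∫ x, |f x|) ^ 2 := by
  obtain ⟨h1, h2⟩ := memLp_sub_translateAverage hν hf hfg hg
  have hAi := integrable_translateAverage (ν := ν) hf
  -- Interpolation between `L¹` and `L^∞`; the average is in both, hence in `L²`.
  have hle : ∀ x, translateAverage ν f x ^ 2 ≤ B * (∫ x, |f x|) * |translateAverage ν f x| :=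
    fun x => by
      rw [← sq_abs, sq]
      exact mul_le_mul_of_nonneg_right (hB x) (abs_nonneg _)
  have hA : MemLp (translateAverage ν f) 2 volume :=
    memLp_two_of_sq_le hAi.aestronglyMeasurable (hAi.abs.const_mul _) (Eventually.of_forall hle)
  have hmem : MemLp f 2 volume := by
    convert hA.sub h1 using 1
    ext x
    simp
  have hBf : 0 ≤ B * ∫ x, |f x| := (abs_nonneg _).trans (hB 0)
  have hA2 : ∫ x, translateAverage ν f x ^ 2 ≤ B * (∫ x, |f x|) ^ 2 :=
    calc _ ≤ ∫ x, B * (∫ x, |f x|) * |translateAverage ν f x| :=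
          integral_mono hA.integrable_sq (hAi.abs.const_mul _) hle
      _ = B * (∫ x, |f x|) * ∫ x, |translateAverage ν f x| := integral_const_mul _ _
      _ ≤ B * (∫ x, |f x|) * ∫ x, |f x| := by
          exact mul_le_mul_of_nonneg_left (integral_abs_translateAverage_le hf) hBf
      _ = _ := by ring
  refine ⟨hmem, ?_⟩
  calc ∫ x, f x ^ 2 ≤ ∫ x, (2 * (translateAverage ν f x - f x) ^ 2
        + 2 * translateAverage ν f x ^ 2) := by
        refine integral_mono hmem.integrable_sq
          ((h1.integrable_sq.const_mul 2).add (hA.integrable_sq.const_mul 2)) fun x => ?_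
        -- With `A` the average, `2(A - f)² + 2A² - f² = (2A - f)²`.
        nlinarith [sq_nonneg (2 * translateAverage ν f x - f x)]
    _ = 2 * (∫ x, (translateAverage ν f x - f x) ^ 2) + 2 * ∫ x, translateAverage ν f x ^ 2 := by
        rw [integral_add (h1.integrable_sq.const_mul 2) (hA.integrable_sq.const_mul 2),
          integral_const_mul, integral_const_mul]
    _ ≤ _ := by linarith

end Translation

/-! ### The harmonic potential -/

section Potential

variable {d : ℕ} {γ : Fin d → ℝ}

theorem continuous_harmonicPotential (γ : Fin d → ℝ) : Continuous (harmonicPotential γ) := by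
  unfold harmonicPotential
  fun_prop

theorem harmonicPotential_nonneg (γ : Fin d → ℝ) (x : Space d) : 0 ≤ harmonicPotential γ x := by
  unfold harmonicPotential
  positivity

theorem harmonicPotential_smul (γ : Fin d → ℝ) (c : ℝ) (x : Space d) :
    harmonicPotential γ (c • x) = c ^ 2 * harmonicPotential γ x := by
  simp only [harmonicPotential, PiLp.smul_apply, smul_eq_mul, Finset.mul_sum]
  exact Finset.sum_congr rfl fun i _ => by ring

/-- `V` is a quadratic form. This identity is what makes smoothing by an even kernel shift the
potential energy by an exact constant. -/
theorem harmonicPotential_add_add_sub (γ : Fin d → ℝ) (x y : Space d) :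
    harmonicPotential γ (x + y) + harmonicPotential γ (x - y)
      = 2 * harmonicPotential γ x + 2 * harmonicPotential γ y := by
  simp only [harmonicPotential, PiLp.add_apply, PiLp.sub_apply, Finset.mul_sum,
    ← Finset.sum_add_distrib]
  exact Finset.sum_congr rfl fun i _ => by ring

theorem harmonicPotential_add_le (γ : Fin d → ℝ) (x y : Space d) :
    harmonicPotential γ (x + y) ≤ 2 * harmonicPotential γ x + 2 * harmonicPotential γ y := by
  have := harmonicPotential_add_add_sub γ x y
  linarith [harmonicPotential_nonneg γ (x - y)]

theorem exists_harmonicPotential_le (γ : Fin d → ℝ) :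
    ∃ c, 0 ≤ c ∧ ∀ x, harmonicPotential γ x ≤ c * ‖x‖ ^ 2 := by
  refine ⟨(1 / 2) * ∑ i, γ i ^ 2, by positivity, fun x => ?_⟩
  rw [harmonicPotential, mul_assoc, Finset.sum_mul]
  refine mul_le_mul_of_nonneg_left (Finset.sum_le_sum fun i _ =>
    mul_le_mul_of_nonneg_left ?_ (sq_nonneg _)) (by norm_num)
  rw [EuclideanSpace.real_norm_sq_eq]
  exact Finset.single_le_sum (f := fun i => x i ^ 2) (fun j _ => sq_nonneg _) (Finset.mem_univ i)

theorem exists_le_harmonicPotential (hγ : ∀ i, 0 < γ i) :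
    ∃ c, 0 < c ∧ ∀ x, c * ‖x‖ ^ 2 ≤ harmonicPotential γ x := by
  obtain ⟨m, hm, hle⟩ : ∃ m, 0 < m ∧ ∀ i, m ≤ γ i ^ 2 := by
    rcases isEmpty_or_nonempty (Fin d) with h | h
    · exact ⟨1, one_pos, fun i => h.elim i⟩
    · obtain ⟨j, hj⟩ := Finite.exists_min fun i => γ i ^ 2
      exact ⟨γ j ^ 2, pow_pos (hγ j) 2, hj⟩
  refine ⟨m / 2, by positivity, fun x => ?_⟩
  rw [EuclideanSpace.real_norm_sq_eq, harmonicPotential, Finset.mul_sum, Finset.mul_sum]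
  refine Finset.sum_le_sum fun i _ => ?_
  nlinarith [mul_le_mul_of_nonneg_right (hle i) (sq_nonneg (x i))]

end Potential

/-! ### Smoothing kernels -/

section Kernel

variable {d : ℕ} {K f : Space d → ℝ}

/-- A positive, even probability density with finite second moment and bounded logarithmic
derivative. -/
structure IsSmoothingKernel (K : Space d → ℝ) : Prop where
  contDiff : ContDiff ℝ 1 K
  pos : ∀ x, 0 < K x
  even : ∀ x, K (-x) = K x
  integral_eq_one : ∫ x, K x = 1
  moment : Integrable (fun x => ‖x‖ ^ 2 * K x) volume
  bounded : ∃ B, ∀ x, K x ≤ B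
  norm_fderiv_le : ∃ C, 0 ≤ C ∧ ∀ x, ‖fderiv ℝ K x‖ ≤ C * K x

/-- The measure with density `K`. -/
noncomputable def kernelMeasure (K : Space d → ℝ) : Measure (Space d) :=
  volume.withDensity fun x => ENNReal.ofReal (K x)

namespace IsSmoothingKernel

theorem integrable (hK : IsSmoothingKernel K) : Integrable K volume :=
  Integrable.of_integral_ne_zero (by rw [hK.integral_eq_one]; exact one_ne_zero)

theorem continuous (hK : IsSmoothingKernel K) : Continuous K := hK.contDiff.continuous

theorem isProbabilityMeasure (hK : IsSmoothingKernel K) :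
    IsProbabilityMeasure (kernelMeasure K) := by
  refine ⟨?_⟩
  rw [kernelMeasure, withDensity_apply _ MeasurableSet.univ, Measure.restrict_univ,
    ← ofReal_integral_eq_lintegral_ofReal hK.integrable (Eventually.of_forall fun x => (hK.pos x).le),
    hK.integral_eq_one, ENNReal.ofReal_one]

theorem integral_kernelMeasure (hK : IsSmoothingKernel K) (u : Space d → ℝ) :
    ∫ y, u y ∂(kernelMeasure K) = ∫ y, K y * u y := by
  rw [kernelMeasure, integral_withDensity_eq_integral_toReal_smul
    hK.continuous.measurable.ennreal_ofReal (Eventually.of_forall fun x => ENNReal.ofReal_lt_top)]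
  simp [ENNReal.toReal_ofReal (hK.pos _).le]

theorem integrable_kernelMeasure (hK : IsSmoothingKernel K) (u : Space d → ℝ) :
    Integrable u (kernelMeasure K) ↔ Integrable (fun y => K y * u y) volume := by
  rw [kernelMeasure, integrable_withDensity_iff_integrable_smul'
    hK.continuous.measurable.ennreal_ofReal (Eventually.of_forall fun x => ENNReal.ofReal_lt_top)]
  simp [ENNReal.toReal_ofReal (hK.pos _).le]

theorem moment_kernelMeasure (hK : IsSmoothingKernel K) :
    Integrable (fun y => ‖y‖ ^ 2) (kernelMeasure K) := by
  rw [hK.integrable_kernelMeasure]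
  simpa [mul_comm] using hK.moment

theorem translateAverage_eq (hK : IsSmoothingKernel K) (f : Space d → ℝ) (x : Space d) :
    translateAverage (kernelMeasure K) f x = ∫ z, K (x - z) * f z := by
  rw [translateAverage, hK.integral_kernelMeasure, ← integral_sub_left_eq_self _ volume x]
  simp

theorem integrable_mul (hK : IsSmoothingKernel K) (hf : Integrable f volume) (x : Space d) :
    Integrable (fun z => K (x - z) * f z) volume := by
  obtain ⟨B, hB⟩ := hK.bounded
  refine hf.bdd_mul (c := B) (hK.continuous.comp (by fun_prop)).aestronglyMeasurable
    (Eventually.of_forall fun z => ?_)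
  rw [Real.norm_of_nonneg (hK.pos _).le]
  exact hB _

theorem abs_translateAverage_le (hK : IsSmoothingKernel K) {B : ℝ} (hB : ∀ x, K x ≤ B)
    (hf : Integrable f volume) (x : Space d) :
    |translateAverage (kernelMeasure K) f x| ≤ B * ∫ z, |f z| := by
  rw [hK.translateAverage_eq, ← integral_const_mul]
  refine abs_integral_le_integral_abs.trans
    (integral_mono (hK.integrable_mul hf x).abs (hf.abs.const_mul _) fun z => ?_)
  simp only [abs_mul, abs_of_pos (hK.pos _)]
  exact mul_le_mul_of_nonneg_right (hB _) (abs_nonneg _)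

/-- Since the kernel vanishes nowhere, a zero of the average at a single point would force `f = 0`
almost everywhere, against mass `1`. -/
theorem translateAverage_pos (hK : IsSmoothingKernel K) (hf : Integrable f volume)
    (h0 : 0 ≤ᵐ[volume] f) (h1 : ∫ x, f x = 1) (x : Space d) :
    0 < translateAverage (kernelMeasure K) f x := by
  rw [hK.translateAverage_eq]
  have hnn : 0 ≤ᵐ[volume] fun z => K (x - z) * f z := by
    filter_upwards [h0] with z hz using mul_nonneg (hK.pos _).le hz
  refine lt_of_le_of_ne (integral_nonneg_of_ae hnn) fun h => ?_
  rw [eq_comm, integral_eq_zero_iff_of_nonneg_ae hnn (hK.integrable_mul hf x)] at h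
  have hz : f =ᵐ[volume] 0 := by
    filter_upwards [h] with z hz
    simpa [(hK.pos _).ne'] using hz
  rw [integral_congr_ae hz] at h1
  simp at h1

theorem hasFDerivAt_translateAverage (hK : IsSmoothingKernel K) (hf : Integrable f volume)
    (x : Space d) :
    HasFDerivAt (translateAverage (kernelMeasure K) f) (∫ z, f z • fderiv ℝ K (x - z)) x := by
  obtain ⟨B, hB⟩ := hK.bounded
  obtain ⟨C, hC0, hC⟩ := hK.norm_fderiv_le
  have hc : Continuous (fderiv ℝ K) := hK.contDiff.continuous_fderiv (by simp)
  have : translateAverage (kernelMeasure K) f = fun x => ∫ z, K (x - z) * f z :=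
    funext (hK.translateAverage_eq f)
  rw [this]
  refine hasFDerivAt_integral_of_dominated_of_fderiv_le (𝕜 := ℝ) (s := Set.univ)
    (F' := fun x z => f z • fderiv ℝ K (x - z))
    (bound := fun z => (C * B) * |f z|) univ_mem
    (Eventually.of_forall fun x => (hK.integrable_mul hf x).aestronglyMeasurable)
    (hK.integrable_mul hf x) ?_ ?_ (hf.abs.const_mul _) ?_
  · exact hf.aestronglyMeasurable.smul (hc.comp (by fun_prop)).aestronglyMeasurable
  · refine Eventually.of_forall fun z y _ => ?_
    rw [norm_smul, Real.norm_eq_abs, mul_comm]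
    exact mul_le_mul_of_nonneg_right
      ((hC _).trans (mul_le_mul_of_nonneg_left (hB _) hC0)) (abs_nonneg _)
  · refine Eventually.of_forall fun z y _ => ?_
    have h1 : HasFDerivAt (fun y => K (y - z)) (fderiv ℝ K (y - z)) y := by
      rw [hasFDerivAt_comp_sub]
      exact ((hK.contDiff.differentiable (by simp)) (y - z)).hasFDerivAt
    exact h1.mul_const (f z)

/-- A bound of the gradient by the function is linear, so it passes from the kernel to its averages
against nonnegative functions. It is what puts the square root of the smoothed density in `H¹`. -/
theorem norm_fderiv_translateAverage_le (hK : IsSmoothingKernel K) {C : ℝ}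
    (hC : ∀ x, ‖fderiv ℝ K x‖ ≤ C * K x) (hf : Integrable f volume)
    (h0 : 0 ≤ᵐ[volume] f) (x : Space d) :
    ‖fderiv ℝ (translateAverage (kernelMeasure K) f) x‖
      ≤ C * translateAverage (kernelMeasure K) f x := by
  rw [(hK.hasFDerivAt_translateAverage hf x).fderiv, hK.translateAverage_eq, ← integral_const_mul]
  refine norm_integral_le_of_norm_le ((hK.integrable_mul hf x).const_mul C) ?_
  filter_upwards [h0] with z hz
  rw [norm_smul, Real.norm_of_nonneg hz, mul_comm, ← mul_assoc]
  exact mul_le_mul_of_nonneg_right (hC _) hz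

theorem integrable_harmonicPotential_mul (hK : IsSmoothingKernel K) (γ : Fin d → ℝ) :
    Integrable (fun y => K y * harmonicPotential γ y) volume := by
  obtain ⟨c, hc, hle⟩ := exists_harmonicPotential_le γ
  refine (hK.moment.const_mul c).mono'
    (hK.continuous.mul (continuous_harmonicPotential γ)).aestronglyMeasurable
    (Eventually.of_forall fun y => ?_)
  rw [Real.norm_of_nonneg (mul_nonneg (hK.pos y).le (harmonicPotential_nonneg γ y))]
  nlinarith [mul_le_mul_of_nonneg_left (hle y) (hK.pos y).le]

/-- Evenness lets `y` be replaced by `-y`; summing the two versions cancels the cross term by the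
parallelogram identity for `V`. -/
theorem integral_harmonicPotential_add (hK : IsSmoothingKernel K) (γ : Fin d → ℝ) (z : Space d) :
    ∫ y, harmonicPotential γ (z + y) ∂(kernelMeasure K)
      = harmonicPotential γ z + ∫ y, harmonicPotential γ y ∂(kernelMeasure K) := by
  simp only [hK.integral_kernelMeasure]
  have hint := hK.integrable_harmonicPotential_mul γ
  have hi : Integrable (fun y => K y * harmonicPotential γ (z + y)) volume := by
    refine ((hK.integrable.mul_const (2 * harmonicPotential γ z)).add (hint.const_mul 2)).mono'
      (hK.continuous.mul ((continuous_harmonicPotential γ).comp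
        (by fun_prop))).aestronglyMeasurable (Eventually.of_forall fun y => ?_)
    rw [Real.norm_of_nonneg (mul_nonneg (hK.pos y).le (harmonicPotential_nonneg γ _))]
    simp only [Pi.add_apply]
    nlinarith [mul_le_mul_of_nonneg_left (harmonicPotential_add_le γ z y) (hK.pos y).le]
  have hneg : ∫ y, K y * harmonicPotential γ (z - y) = ∫ y, K y * harmonicPotential γ (z + y) := by
    rw [← integral_neg_eq_self]
    simp [hK.even]
  have hi' : Integrable (fun y => K y * harmonicPotential γ (z - y)) volume := by
    have := hi.comp_neg
    simpa [hK.even, ← sub_eq_add_neg] using this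
  have hsum := integral_add hi hi'
  simp only [← mul_add (K _), harmonicPotential_add_add_sub] at hsum
  rw [hneg] at hsum
  have h2 : ∫ y, K y * (2 * harmonicPotential γ z + 2 * harmonicPotential γ y)
      = 2 * harmonicPotential γ z + 2 * ∫ y, K y * harmonicPotential γ y := by
    have : ∀ y, K y * (2 * harmonicPotential γ z + 2 * harmonicPotential γ y)
        = K y * (2 * harmonicPotential γ z) + 2 * (K y * harmonicPotential γ y) := fun y => by ring
    simp_rw [this]
    rw [integral_add (hK.integrable.mul_const _) (hint.const_mul 2), integral_mul_const,
      integral_const_mul, hK.integral_eq_one, one_mul]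
  linarith

theorem integral_harmonicPotential_mul_translateAverage (hK : IsSmoothingKernel K)
    (γ : Fin d → ℝ) (hf : Integrable f volume)
    (hV : Integrable (fun x => harmonicPotential γ x * f x) volume) :
    Integrable (fun x => harmonicPotential γ x * translateAverage (kernelMeasure K) f x) volume ∧
      ∫ x, harmonicPotential γ x * translateAverage (kernelMeasure K) f x
        = ∫ x, harmonicPotential γ x * f x
          + (∫ y, harmonicPotential γ y ∂(kernelMeasure K)) * f x := by
  have := hK.isProbabilityMeasure
  set ν := kernelMeasure K
  have hVν : Integrable (harmonicPotential γ) ν :=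
    (hK.integrable_kernelMeasure _).2 (hK.integrable_harmonicPotential_mul γ)
  have hT := measurePreserving_sub_prod (volume : Measure (Space d)) ν
  have hG : Integrable (fun z : Space d × Space d => harmonicPotential γ (z.1 + z.2) * f z.1)
      (volume.prod ν) := by
    refine ((hV.comp_fst ν).abs.const_mul 2 |>.add
      ((hf.abs.mul_prod hVν).const_mul 2)).mono'
      ((((continuous_harmonicPotential γ).comp (by fun_prop)).aestronglyMeasurable).mul
        (hf.comp_fst ν).aestronglyMeasurable) (Eventually.of_forall fun z => ?_)
    simp only [Pi.add_apply, Real.norm_eq_abs, abs_mul,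
      abs_of_nonneg (harmonicPotential_nonneg γ _)]
    nlinarith [mul_le_mul_of_nonneg_right (harmonicPotential_add_le γ z.1 z.2) (abs_nonneg (f z.1))]
  -- Through the shear `(x, y) ↦ (x - y, y)`, `V(x + y) f(x)` becomes `V(x) f(x - y)`, so the
  -- potential energy of the average reduces to averaging translates of `V`.
  have hH := hT.integrable_comp_of_integrable hG
  have hI := integral_map hT.measurable.aemeasurable
    (f := fun z : Space d × Space d => harmonicPotential γ (z.1 + z.2) * f z.1)
    (by rw [hT.map_eq]; exact hG.aestronglyMeasurable)
  rw [hT.map_eq, integral_prod _ hG] at hI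
  have hH' : Integrable (fun z : Space d × Space d => harmonicPotential γ z.1 * f (z.1 - z.2))
      (volume.prod ν) := by
    simpa [Function.comp_def] using hH
  simp only [sub_add_cancel] at hI
  rw [integral_prod _ hH'] at hI
  simp only [integral_const_mul, integral_mul_const, hK.integral_harmonicPotential_add γ, ν] at hI
  refine ⟨?_, ?_⟩
  · have h := hH'.integral_prod_left
    simp only [integral_const_mul] at h
    exact h
  · simp only [translateAverage, add_mul, ν] at hI ⊢
    exact hI.symm

theorem scale (hK : IsSmoothingKernel K) {s : ℝ} (hs : 0 < s) :
    IsSmoothingKernel fun x => (s ^ d)⁻¹ * K (s⁻¹ • x) := by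
  have hsd : 0 < (s ^ d)⁻¹ := inv_pos.2 (pow_pos hs d)
  refine ⟨contDiff_const.mul (hK.contDiff.comp (contDiff_id.const_smul _)),
    fun x => mul_pos hsd (hK.pos _), fun x => by rw [smul_neg, hK.even], ?_, ?_, ?_, ?_⟩
  · rw [integral_const_mul, Measure.integral_comp_smul, hK.integral_eq_one]
    simp [abs_of_pos hs, (pow_pos hs d).ne']
  · have h := ((integrable_comp_smul_iff volume _ (inv_ne_zero hs.ne')).2 hK.moment).const_mul
      ((s ^ d)⁻¹ * s ^ 2)
    refine h.congr (Eventually.of_forall fun x => ?_)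
    simp only [norm_smul, norm_inv, Real.norm_eq_abs, mul_pow, inv_pow, sq_abs]
    field_simp
  · obtain ⟨B, hB⟩ := hK.bounded
    exact ⟨(s ^ d)⁻¹ * B, fun x => mul_le_mul_of_nonneg_left (hB _) hsd.le⟩
  · obtain ⟨C, hC0, hC⟩ := hK.norm_fderiv_le
    refine ⟨s⁻¹ * C, mul_nonneg (inv_pos.2 hs).le hC0, fun x => ?_⟩
    have hd : DifferentiableAt ℝ (fun x => K (s⁻¹ • x)) x :=
      (hK.contDiff.comp (contDiff_id.const_smul _)).differentiable (by simp) x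
    rw [fderiv_const_mul hd, fderiv_comp_smul, norm_smul, norm_smul,
      Real.norm_of_nonneg hsd.le, Real.norm_of_nonneg (inv_pos.2 hs).le]
    have := mul_le_mul_of_nonneg_left (hC (s⁻¹ • x)) (mul_pos hsd (inv_pos.2 hs)).le
    linarith

/-- Used both with `u = V`, to make the cost of smoothing small, and with `u = ‖·‖²`, to see the
scale in the Nash inequality. -/
theorem integral_scale (hK : IsSmoothingKernel K) {s : ℝ} (hs : 0 < s) {u : Space d → ℝ}
    (hu : ∀ x, u (s⁻¹ • x) = (s ^ 2)⁻¹ * u x) :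
    ∫ y, u y ∂(kernelMeasure fun x => (s ^ d)⁻¹ * K (s⁻¹ • x))
      = s ^ 2 * ∫ y, u y ∂(kernelMeasure K) := by
  rw [(hK.scale hs).integral_kernelMeasure, hK.integral_kernelMeasure]
  have h1 : ∀ x, (s ^ d)⁻¹ * K (s⁻¹ • x) * u x
      = ((s ^ d)⁻¹ * s ^ 2) * (K (s⁻¹ • x) * u (s⁻¹ • x)) := fun x => by
    rw [hu]
    field_simp
  simp_rw [h1]
  rw [integral_const_mul, Measure.integral_comp_smul _ fun x => K x * u x]
  have := (pow_pos hs d).ne'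
  simp [abs_of_pos hs]
  field_simp

end IsSmoothingKernel

/-- The unnormalized kernel `(1 + |x|²)^{-(d+2)}`. -/
noncomputable def algebraicKernel (d : ℕ) (x : Space d) : ℝ := ((1 + ‖x‖ ^ 2) ^ (d + 2))⁻¹

theorem algebraicKernel_pos (x : Space d) : 0 < algebraicKernel d x := by
  unfold algebraicKernel
  positivity

theorem contDiff_algebraicKernel : ContDiff ℝ 1 (algebraicKernel d) := by
  unfold algebraicKernel
  refine ContDiff.inv ((contDiff_const.add (contDiff_norm_sq ℝ)).pow _) fun x => ?_
  positivity

/-- The logarithmic derivative has norm `(d + 2) · 2‖x‖ / (1 + ‖x‖²)`, and `2‖x‖ ≤ 1 + ‖x‖²`.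
Algebraic decay matters: the logarithmic derivative of a Gaussian is unbounded. -/
theorem norm_fderiv_algebraicKernel_le (x : Space d) :
    ‖fderiv ℝ (algebraicKernel d) x‖ ≤ (d + 2 : ℝ) * algebraicKernel d x := by
  have hq : 0 < 1 + ‖x‖ ^ 2 := by positivity
  have h1 : HasFDerivAt (fun x : Space d => 1 + ‖x‖ ^ 2) (2 • innerSL ℝ x) x :=
    (hasStrictFDerivAt_norm_sq x).hasFDerivAt.const_add 1
  have h0 : HasDerivAt (fun t : ℝ => (t ^ (d + 2))⁻¹) _ (1 + ‖x‖ ^ 2) :=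
    (hasDerivAt_pow (d + 2) (1 + ‖x‖ ^ 2)).fun_inv (pow_pos hq _).ne'
  have h2 := h0.comp_hasFDerivAt x h1
  have h3 : fderiv ℝ (algebraicKernel d) x = _ := h2.fderiv
  have hx : ‖(2 : ℕ) • innerSL ℝ x‖ ≤ 1 + ‖x‖ ^ 2 := by
    rw [← Nat.cast_smul_eq_nsmul ℝ, norm_smul, innerSL_apply_norm]
    simp only [Nat.cast_ofNat, Real.norm_ofNat]
    nlinarith [sq_nonneg (‖x‖ - 1)]
  have e : ‖-(((d + 2 : ℕ) : ℝ) * (1 + ‖x‖ ^ 2) ^ (d + 2 - 1)) / ((1 + ‖x‖ ^ 2) ^ (d + 2)) ^ 2‖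
      = (d + 2) * ((1 + ‖x‖ ^ 2) ^ (d + 2))⁻¹ * (1 + ‖x‖ ^ 2)⁻¹ := by
    rw [neg_div, norm_neg, Real.norm_of_nonneg (by positivity), Nat.add_succ_sub_one]
    push_cast
    field_simp
    ring
  rw [h3, norm_smul, e, algebraicKernel]
  calc _ ≤ (d + 2) * ((1 + ‖x‖ ^ 2) ^ (d + 2))⁻¹ * (1 + ‖x‖ ^ 2)⁻¹ * (1 + ‖x‖ ^ 2) := by gcongr
    _ = _ := inv_mul_cancel_right₀ hq.ne' _

theorem integrable_pow_inv {m : ℕ} (hm : d < 2 * m) :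
    Integrable (fun x : Space d => ((1 + ‖x‖ ^ 2) ^ m)⁻¹) volume := by
  have h := integrable_rpow_neg_one_add_norm_sq (E := Space d) (μ := volume) (r := 2 * m)
    (by rw [finrank_euclideanSpace_fin]; exact_mod_cast hm)
  refine h.congr (Eventually.of_forall fun x => ?_)
  have hq : 0 ≤ 1 + ‖x‖ ^ 2 := by positivity
  simp only []
  rw [show -(2 * (m : ℝ)) / 2 = -(m : ℝ) by ring, Real.rpow_neg hq, Real.rpow_natCast]

theorem exists_isSmoothingKernel (d : ℕ) : ∃ K : Space d → ℝ, IsSmoothingKernel K := by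
  have hi : Integrable (algebraicKernel d) volume := integrable_pow_inv (by omega)
  have hZ : 0 < ∫ x, algebraicKernel d x := by
    rw [integral_pos_iff_support_of_nonneg (fun x => (algebraicKernel_pos x).le) hi]
    have : Function.support (algebraicKernel d) = Set.univ := by
      ext x
      simp [(algebraicKernel_pos x).ne']
    simp [this, NeZero.ne]
  generalize hZe : ∫ x, algebraicKernel d x = Z at hZ
  refine ⟨fun x => Z⁻¹ * algebraicKernel d x, contDiff_const.mul contDiff_algebraicKernel,
    fun x => mul_pos (inv_pos.2 hZ) (algebraicKernel_pos x), fun x => by simp [algebraicKernel],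
    by rw [integral_const_mul, hZe, inv_mul_cancel₀ hZ.ne'], ?_, ⟨Z⁻¹, fun x => ?_⟩,
    ⟨d + 2, by positivity, fun x => ?_⟩⟩
  -- The factor `‖x‖²` costs one power of `1 + ‖x‖²`; exponent `d + 1` is still integrable because
  -- `d < 2(d + 1)`.
  · refine ((integrable_pow_inv (d := d) (m := d + 1) (by omega)).const_mul Z⁻¹).mono'
      (by have := (contDiff_algebraicKernel (d := d)).continuous; fun_prop)
      (Eventually.of_forall fun x => ?_)
    have h := algebraicKernel_pos x
    rw [Real.norm_of_nonneg (by positivity), mul_left_comm]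
    refine mul_le_mul_of_nonneg_left ?_ (inv_pos.2 hZ).le
    rw [algebraicKernel, pow_succ _ (d + 1), mul_inv, mul_left_comm]
    refine mul_le_of_le_one_right (by positivity) ?_
    rw [← div_eq_mul_inv, div_le_one (by positivity)]
    linarith
  · refine mul_le_of_le_one_right (inv_pos.2 hZ).le ?_
    exact inv_le_one_of_one_le₀ (one_le_pow₀ (by nlinarith [sq_nonneg ‖x‖]))
  · rw [fderiv_const_mul (contDiff_algebraicKernel.differentiable (by simp) x), norm_smul,
      Real.norm_of_nonneg (inv_pos.2 hZ).le, mul_left_comm]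
    exact mul_le_mul_of_nonneg_left (norm_fderiv_algebraicKernel_le x) (inv_pos.2 hZ).le

end Kernel

/-! ### The squared weak gradient -/

section GradSq

variable {d : ℕ} {F : Type*} [NormedAddCommGroup F] [NormedSpace ℝ F] {f : Space d → F}

theorem gradSq_nonneg (f : Space d → F) (x : Space d) : 0 ≤ gradSq f x :=
  Finset.sum_nonneg fun _ _ => sq_nonneg _

theorem HasL2WeakGrad.integrable_norm_sq [CompleteSpace F] (h : HasL2WeakGrad f) (i : Fin d) :
    Integrable (fun x => ‖weakPartial i f x‖ ^ 2) volume :=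
  (memLp_two_iff_integrable_sq_norm (h.memLp i).aestronglyMeasurable).1 (h.memLp i)

theorem HasL2WeakGrad.integrable_gradSq [CompleteSpace F] (h : HasL2WeakGrad f) :
    Integrable (gradSq f) volume :=
  integrable_finsetSum _ fun i _ => h.integrable_norm_sq i

theorem HasL2WeakGrad.integral_gradSq [CompleteSpace F] (h : HasL2WeakGrad f) :
    ∫ x, gradSq f x = ∑ i, ∫ x, ‖weakPartial i f x‖ ^ 2 :=
  integral_finsetSum _ fun i _ => h.integrable_norm_sq i

theorem gradSq_ae_eq [CompleteSpace F] {g : Fin d → Space d → F}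
    (h : ∀ i, HasWeakPartial i f (g i)) :
    gradSq f =ᵐ[volume] fun x => ∑ i, ‖g i x‖ ^ 2 := by
  have : ∀ᵐ x, ∀ i, weakPartial i f x = g i x := ae_all_iff.2 fun i => (h i).weakPartial_ae_eq
  filter_upwards [this] with x hx
  simp [gradSq, hx]

theorem HasL2WeakGrad.congr {f' : Space d → F} (h : HasL2WeakGrad f) (hf : f =ᵐ[volume] f') :
    HasL2WeakGrad f' := fun i =>
  let ⟨g, hg, hg2⟩ := h i
  ⟨g, hg.congr hf (ae_eq_refl g), hg2⟩

theorem gradSq_congr_ae [CompleteSpace F] {f' : Space d → F} (h : HasL2WeakGrad f)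
    (hf : f =ᵐ[volume] f') : gradSq f' =ᵐ[volume] gradSq f :=
  gradSq_ae_eq fun i => (h.hasWeakPartial i).congr hf (ae_eq_refl _)

theorem HasL2WeakGrad.sub {f' : Space d → F} (h : HasL2WeakGrad f) (h' : HasL2WeakGrad f') :
    HasL2WeakGrad (f - f') := fun i =>
  let ⟨g, hg, hg2⟩ := h i
  let ⟨g', hg', hg2'⟩ := h' i
  ⟨g - g', hg.sub hg', hg2.sub hg2'⟩

theorem HasL2WeakGrad.add {f' : Space d → F} (h : HasL2WeakGrad f) (h' : HasL2WeakGrad f') :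
    HasL2WeakGrad (f + f') := fun i =>
  let ⟨g, hg, hg2⟩ := h i
  let ⟨g', hg', hg2'⟩ := h' i
  ⟨g + g', hg.add hg', hg2.add hg2'⟩

theorem HasL2WeakGrad.const_smul (h : HasL2WeakGrad f) (c : ℝ) : HasL2WeakGrad (c • f) := fun i =>
  let ⟨g, hg, hg2⟩ := h i
  ⟨c • g, hg.const_smul c, hg2.const_smul c⟩

end GradSq

/-! ### Trapped densities and their approximation by states -/

section Trapped

variable {d : ℕ} {γ : Fin d → ℝ} {ρ : Space d → ℝ} {φ : Space d → ℂ}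

/-- `ρ` is a probability density with `∫ Vρ < ∞`. -/
structure IsTrappedDensity (V ρ : Space d → ℝ) : Prop where
  integrable : Integrable ρ volume
  nonneg : 0 ≤ᵐ[volume] ρ
  integral_eq_one : ∫ x, ρ x = 1
  integrable_mul : Integrable (fun x => V x * ρ x) volume

theorem density_nonneg (φ : Space d → ℂ) (x : Space d) : 0 ≤ density φ x := sq_nonneg _

theorem IsTrappedState.isTrappedDensity {V : Space d → ℝ} (h : IsTrappedState V φ) :
    IsTrappedDensity V (density φ) :=
  ⟨(memLp_two_iff_integrable_sq_norm h.1.aestronglyMeasurable).1 h.1,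
    Eventually.of_forall (density_nonneg φ), h.2.1, h.2.2⟩

/-- The nonnegative state with density `ρ`. -/
noncomputable def sqrtState (ρ : Space d → ℝ) (x : Space d) : ℂ := (√(ρ x) : ℝ)

theorem density_sqrtState {x : Space d} (h : 0 ≤ ρ x) : density (sqrtState ρ) x = ρ x := by
  simp [density, sqrtState, Real.sq_sqrt h]

theorem density_sqrtState_ae (h : 0 ≤ᵐ[volume] ρ) : density (sqrtState ρ) =ᵐ[volume] ρ := by
  filter_upwards [h] with x hx using density_sqrtState hx

theorem IsTrappedDensity.isTrappedState {V : Space d → ℝ} (h : IsTrappedDensity V ρ) :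
    IsTrappedState V (sqrtState ρ) := by
  have hae := density_sqrtState_ae h.nonneg
  have hm : AEStronglyMeasurable (sqrtState ρ) volume :=
    Complex.continuous_ofReal.comp_aestronglyMeasurable
      (Real.continuous_sqrt.comp_aestronglyMeasurable h.integrable.aestronglyMeasurable)
  refine ⟨(memLp_two_iff_integrable_sq_norm hm).2 (h.integrable.congr hae.symm),
    (integral_congr_ae hae).trans h.integral_eq_one, h.integrable_mul.congr ?_⟩
  filter_upwards [hae] with x hx
  rw [hx]

/-- A nonnegative state is recovered from its density, so uniqueness of a minimizing density gives
uniqueness of the nonnegative minimizer. -/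
theorem eq_sqrtState_density {x : Space d} (h : 0 ≤ (φ x).re ∧ (φ x).im = 0) :
    φ x = sqrtState (density φ) x := by
  have h1 : φ x = ((φ x).re : ℂ) := Complex.ext (by simp) (by simp [h.2])
  rw [sqrtState, density, Real.sqrt_sq (norm_nonneg _), h1, Complex.norm_real,
    Real.norm_of_nonneg h.1]

/-- States with smooth densities. -/
theorem sqrtState_of_logarithmic_bound {u : Space d → ℝ} (hu : Differentiable ℝ u)
    (hpos : ∀ x, 0 < u x) (hi : Integrable u volume) (hu2 : MemLp u 2 volume) {C : ℝ}
    (hC : ∀ x, ‖fderiv ℝ u x‖ ≤ C * u x) :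
    MemH1 (sqrtState u) ∧ HasL2WeakGrad u := by
  have hsq : Differentiable ℝ fun x => √(u x) := fun x => (hu x).sqrt (hpos x).ne'
  have hφ : Differentiable ℝ (sqrtState u) := Complex.ofRealCLM.differentiable.comp hsq
  have hs2 : MemLp (fun x => √(u x)) 2 volume := by
    rw [memLp_two_iff_integrable_sq hsq.continuous.aestronglyMeasurable]
    simpa [Real.sq_sqrt (hpos _).le] using hi
  -- The gradient of `√u` is `∇u / (2√u)`, hence at most `(C/2)√u`, and `√u` is in `L²` because `u`
  -- is integrable.
  have hφ' : ∀ x v, ‖fderiv ℝ (sqrtState u) x v‖ ≤ C / 2 * √(u x) * ‖v‖ := fun x v => by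
    have h1 : HasFDerivAt (sqrtState u)
        (Complex.ofRealCLM.comp ((1 / (2 * √(u x))) • fderiv ℝ u x)) x :=
      Complex.ofRealCLM.hasFDerivAt.comp x ((hu x).hasFDerivAt.sqrt (hpos x).ne')
    have hs := Real.sqrt_pos.2 (hpos x)
    rw [h1.fderiv]
    simp only [ContinuousLinearMap.comp_apply, Complex.ofRealCLM_apply, Complex.norm_real,
      smul_apply, norm_smul]
    rw [Real.norm_of_nonneg (by positivity)]
    calc _ ≤ 1 / (2 * √(u x)) * (C * u x * ‖v‖) := by
          gcongr
          exact (ContinuousLinearMap.le_opNorm _ _).trans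
            (mul_le_mul_of_nonneg_right (hC x) (norm_nonneg _))
      _ = _ := by
          nth_rewrite 2 [← Real.mul_self_sqrt (hpos x).le]
          field_simp
  have hφm : MemLp (sqrtState u) 2 volume := by
    refine hs2.of_le hφ.continuous.aestronglyMeasurable (Eventually.of_forall fun x => ?_)
    simp [sqrtState]
  have hgφ : ∀ i, MemLp (fun x => fderiv ℝ (sqrtState u) x (EuclideanSpace.single i 1)) 2
      volume := fun i => by
    refine (hs2.const_mul (C / 2)).mono'
      (measurable_fderiv_apply_const ℝ _ _).aestronglyMeasurable
      (Eventually.of_forall fun x => ?_)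
    simpa using hφ' x (EuclideanSpace.single i 1)
  have hgu : ∀ i, MemLp (fun x => fderiv ℝ u x (EuclideanSpace.single i 1)) 2
      volume := fun i => by
    refine (hu2.const_mul C).mono'
      (measurable_fderiv_apply_const ℝ _ _).aestronglyMeasurable
      (Eventually.of_forall fun x => (ContinuousLinearMap.le_opNorm _ _).trans ?_)
    simpa using hC x
  exact ⟨⟨hφm, fun i => ⟨_, .of_differentiable hφ ((hgφ i).locallyIntegrable (by norm_num)),
    hgφ i⟩⟩, fun i => ⟨_, .of_differentiable hu ((hgu i).locallyIntegrable (by norm_num)), hgu i⟩⟩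

/-- Every trapped density can be approximated, in energy, by densities of states in `S`. -/
theorem IsTrappedDensity.exists_mem_stateSet (hρ : IsTrappedDensity (harmonicPotential γ) ρ)
    {η : ℝ} (hη : 0 < η) : ∃ φ ∈ stateSet (harmonicPotential γ),
      (∫ x, harmonicPotential γ x * density φ x) ≤ (∫ x, harmonicPotential γ x * ρ x) + η ∧
      (MemLp ρ 2 volume → ∫ x, density φ x ^ 2 ≤ ∫ x, ρ x ^ 2) ∧
      (HasL2WeakGrad ρ → ∫ x, gradSq (density φ) x ≤ ∫ x, gradSq ρ x) := by
  obtain ⟨K, hK, hKη⟩ : ∃ K : Space d → ℝ, IsSmoothingKernel K ∧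
      ∫ y, harmonicPotential γ y ∂(kernelMeasure K) ≤ η := by
    obtain ⟨K, hK⟩ := exists_isSmoothingKernel d
    set M := ∫ y, harmonicPotential γ y ∂(kernelMeasure K)
    have hM : 0 ≤ M := integral_nonneg (harmonicPotential_nonneg γ)
    -- At scale `s` the kernel's potential energy is `s² M`, so `s² = η / (M + 1)` keeps it below
    -- `η`; the `+ 1` covers `M = 0`.
    have hs : 0 < √(η / (M + 1)) := Real.sqrt_pos.2 (by positivity)
    refine ⟨_, hK.scale hs, ?_⟩
    rw [hK.integral_scale hs fun x => by rw [harmonicPotential_smul, inv_pow],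
      Real.sq_sqrt (by positivity), div_mul_eq_mul_div, div_le_iff₀ (by positivity)]
    nlinarith
  have := hK.isProbabilityMeasure
  set u := translateAverage (kernelMeasure K) ρ with hu
  have hpos : ∀ x, 0 < u x := hK.translateAverage_pos hρ.integrable hρ.nonneg hρ.integral_eq_one
  have hi : Integrable u volume := integrable_translateAverage hρ.integrable
  have hd : Differentiable ℝ u := fun x =>
    (hK.hasFDerivAt_translateAverage hρ.integrable x).differentiableAt
  obtain ⟨hV, hVe⟩ := hK.integral_harmonicPotential_mul_translateAverage γ hρ.integrable
    hρ.integrable_mul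
  obtain ⟨B, hB⟩ := hK.bounded
  obtain ⟨C, hC0, hC⟩ := hK.norm_fderiv_le
  have hu2 : MemLp u 2 volume := by
    refine memLp_two_of_sq_le hi.aestronglyMeasurable
      (hi.const_mul (B * ∫ z, |ρ z|)) (Eventually.of_forall fun x => ?_)
    rw [sq]
    refine mul_le_mul_of_nonneg_right ?_ (hpos x).le
    exact (le_abs_self _).trans (hK.abs_translateAverage_le hB hρ.integrable x)
  obtain ⟨h1, h2⟩ := sqrtState_of_logarithmic_bound hd hpos hi hu2
    (hK.norm_fderiv_translateAverage_le hC hρ.integrable hρ.nonneg)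
  have hden : density (sqrtState u) = u := funext fun x => density_sqrtState (hpos x).le
  have htr : IsTrappedDensity (harmonicPotential γ) u :=
    ⟨hi, Eventually.of_forall fun x => (hpos x).le,
      (integral_translateAverage hρ.integrable).trans hρ.integral_eq_one, hV⟩
  refine ⟨sqrtState u, ⟨htr.isTrappedState, h1, by rwa [hden], by rwa [hden]⟩, ?_, ?_, ?_⟩
  · rw [hden, hVe, integral_add hρ.integrable_mul (hρ.integrable.const_mul _),
      integral_const_mul, hρ.integral_eq_one, mul_one]
    linarith
  · intro h
    rw [hden]
    exact integral_sq_translateAverage_le h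
  · intro h
    have hw : ∀ i, HasWeakPartial i u (translateAverage (kernelMeasure K) (weakPartial i ρ)) :=
      fun i => (h.hasWeakPartial i).translateAverage hρ.integrable (h.memLp i)
    rw [hden, integral_congr_ae (gradSq_ae_eq hw), h.integral_gradSq]
    simp only [Real.norm_eq_abs, sq_abs]
    rw [integral_finsetSum _ fun i _ => (memLp_translateAverage (h.memLp i)).integrable_sq]
    exact Finset.sum_le_sum fun i _ => integral_sq_translateAverage_le (h.memLp i)

/-- A Nash type inequality at scale `s`. -/
theorem exists_nash_constants (d : ℕ) : ∃ M B : ℝ, 0 ≤ M ∧ 0 ≤ B ∧ ∀ s : ℝ, 0 < s →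
    ∀ f : Space d → ℝ, Integrable f volume → HasL2WeakGrad f →
      MemLp f 2 volume ∧
        ∫ x, f x ^ 2 ≤ M * s ^ 2 * (∫ x, gradSq f x) + B * (s ^ d)⁻¹ * (∫ x, |f x|) ^ 2 := by
  obtain ⟨K, hK⟩ := exists_isSmoothingKernel d
  obtain ⟨B, hB⟩ := hK.bounded
  refine ⟨2 * ∫ y, ‖y‖ ^ 2 ∂(kernelMeasure K), 2 * B, ?_, ?_, fun s hs f hf hg => ?_⟩
  · exact mul_nonneg zero_le_two (integral_nonneg fun y => sq_nonneg _)
  · have := (hK.pos 0).trans_le (hB 0)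
    positivity
  · have hKs := hK.scale hs
    have := hKs.isProbabilityMeasure
    have hBs : ∀ x, (s ^ d)⁻¹ * K (s⁻¹ • x) ≤ (s ^ d)⁻¹ * B := fun x =>
      mul_le_mul_of_nonneg_left (hB _) (inv_pos.2 (pow_pos hs d)).le
    obtain ⟨h1, h2⟩ := memLp_two_of_weak_gradient hKs.moment_kernelMeasure
      (hKs.abs_translateAverage_le hBs hf) hf hg.hasWeakPartial hg.memLp
    refine ⟨h1, h2.trans_eq ?_⟩
    rw [hK.integral_scale hs fun x => by
      rw [norm_smul, norm_inv, mul_pow, inv_pow, Real.norm_eq_abs, sq_abs], hg.integral_gradSq]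
    simp only [Real.norm_eq_abs, sq_abs]
    ring

end Trapped

/-! ### Limits in `L²` and Fatou's lemma -/

section SquareIntegrableLimits

variable {α : Type*} [MeasurableSpace α] {μ : Measure α}

theorem tendsto_sqrt_const_mul {ι : Type*} {l : Filter ι} {u : ι → ℝ} (h : Tendsto u l (𝓝 0))
    (C : ℝ) : Tendsto (fun i => √(C * u i)) l (𝓝 0) := by
  have h1 := (Real.continuous_sqrt.tendsto (C * 0)).comp (h.const_mul C)
  rwa [mul_zero, Real.sqrt_zero] at h1

theorem tendsto_eLpNorm_two {ι : Type*} {l : Filter ι} {f : ι → α → ℝ} {g : α → ℝ}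
    (hf : ∀ᶠ i in l, MemLp (f i) 2 μ) (hg : MemLp g 2 μ)
    (h : Tendsto (fun i => ∫ x, (f i x - g x) ^ 2 ∂μ) l (𝓝 0)) :
    Tendsto (fun i => eLpNorm (f i - g) 2 μ) l (𝓝 0) := by
  have h1 : Tendsto (fun i => ENNReal.ofReal (√(∫ x, (f i x - g x) ^ 2 ∂μ))) l (𝓝 0) := by
    simpa using ENNReal.tendsto_ofReal ((Real.continuous_sqrt.tendsto 0).comp h)
  refine h1.congr' ?_
  filter_upwards [hf] with i hi
  exact (eLpNorm_two_eq (hi.sub hg)).symm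

theorem exists_tendsto_of_cauchy {f : ℕ → α → ℝ} (hf : ∀ n, MemLp (f n) 2 μ)
    (h : ∀ ε > 0, ∃ N, ∀ m ≥ N, ∀ n ≥ N, ∫ x, (f m x - f n x) ^ 2 ∂μ ≤ ε) :
    ∃ g, MemLp g 2 μ ∧ Tendsto (fun n => ∫ x, (f n x - g x) ^ 2 ∂μ) atTop (𝓝 0) := by
  have hc : CauchySeq fun n => (hf n).toLp (f n) := by
    rw [EMetric.cauchySeq_iff]
    intro ε hε
    obtain ⟨δ, hδ, hδε⟩ := ENNReal.lt_iff_exists_nnreal_btwn.1 hε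
    have hδ' : (0 : ℝ) < δ := by exact_mod_cast hδ
    obtain ⟨N, hN⟩ := h ((δ : ℝ) ^ 2) (by positivity)
    refine ⟨N, fun m hm n hn => ?_⟩
    rw [Lp.edist_toLp_toLp, eLpNorm_two_eq ((hf m).sub (hf n))]
    refine lt_of_le_of_lt ?_ hδε
    rw [ENNReal.ofReal_le_iff_le_toReal ENNReal.coe_ne_top, ENNReal.coe_toReal]
    exact (Real.sqrt_le_sqrt (hN m hm n hn)).trans_eq (Real.sqrt_sq hδ'.le)
  obtain ⟨G, hG⟩ := cauchySeq_tendsto_of_complete hc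
  refine ⟨G, Lp.memLp G, ?_⟩
  rw [tendsto_iff_edist_tendsto_0] at hG
  have h1 : ∀ n, edist ((hf n).toLp (f n)) G
      = ENNReal.ofReal (√(∫ x, (f n x - G x) ^ 2 ∂μ)) := fun n => by
    conv_lhs => rw [← Lp.toLp_coeFn G (Lp.memLp G)]
    rw [Lp.edist_toLp_toLp, eLpNorm_two_eq ((hf n).sub (Lp.memLp G))]
    rfl
  simp_rw [h1] at hG
  have h2 := ((ENNReal.tendsto_toReal ENNReal.zero_ne_top).comp hG).pow 2
  simpa [Function.comp_def, ENNReal.toReal_ofReal (Real.sqrt_nonneg _),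
    Real.sq_sqrt (integral_nonneg fun x => sq_nonneg _)] using h2

variable {f : ℕ → α → ℝ} {g h : α → ℝ}

theorem tendsto_integral_mul (hf : ∀ n, MemLp (f n) 2 μ) (hg : MemLp g 2 μ) (hh : MemLp h 2 μ)
    (hfg : Tendsto (fun n => ∫ x, (f n x - g x) ^ 2 ∂μ) atTop (𝓝 0)) :
    Tendsto (fun n => ∫ x, h x * f n x ∂μ) atTop (𝓝 (∫ x, h x * g x ∂μ)) := by
  rw [← tendsto_sub_nhds_zero_iff]
  refine squeeze_zero_norm (fun n => ?_) (tendsto_sqrt_const_mul hfg (∫ x, h x ^ 2 ∂μ))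
  have e : (∫ x, h x * f n x ∂μ) - ∫ x, h x * g x ∂μ = ∫ x, h x * (f n x - g x) ∂μ := by
    simp_rw [mul_sub]
    exact (integral_sub (hh.integrable_mul (hf n)) (hh.integrable_mul hg)).symm
  rw [e, Real.norm_eq_abs]
  exact Real.abs_le_sqrt (sq_integral_mul_le hh ((hf n).sub hg))

/-- Expand `‖f n‖² = ‖f n - g‖² + 2⟨g, f n⟩ - ‖g‖²`; the pairing converges by Cauchy–Schwarz. -/
theorem tendsto_integral_sq (hf : ∀ n, MemLp (f n) 2 μ) (hg : MemLp g 2 μ)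
    (hfg : Tendsto (fun n => ∫ x, (f n x - g x) ^ 2 ∂μ) atTop (𝓝 0)) :
    Tendsto (fun n => ∫ x, f n x ^ 2 ∂μ) atTop (𝓝 (∫ x, g x ^ 2 ∂μ)) := by
  have h1 := (hfg.add ((tendsto_integral_mul hf hg hg hfg).const_mul 2)).sub_const
    (∫ x, g x ^ 2 ∂μ)
  have h2 : ∀ n, (∫ x, (f n x - g x) ^ 2 ∂μ) + 2 * (∫ x, g x * f n x ∂μ) - ∫ x, g x ^ 2 ∂μ
      = ∫ x, f n x ^ 2 ∂μ := fun n => by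
    have hm : Integrable (fun x => g x * f n x) μ := hg.integrable_mul (hf n)
    have hs : Integrable (fun x => (f n x - g x) ^ 2) μ := ((hf n).sub hg).integrable_sq
    have hsm : Integrable (fun x => (f n x - g x) ^ 2 + 2 * (g x * f n x)) μ :=
      hs.add (hm.const_mul 2)
    rw [← integral_const_mul, ← integral_add hs (hm.const_mul 2),
      ← integral_sub hsm hg.integrable_sq]
    congr 1
    ext x
    ring
  simp_rw [h2] at h1
  convert h1 using 2
  simp_rw [← sq]
  ring

theorem exists_subseq_tendsto_ae (hf : ∀ n, MemLp (f n) 2 μ) (hg : MemLp g 2 μ)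
    (hfg : Tendsto (fun n => ∫ x, (f n x - g x) ^ 2 ∂μ) atTop (𝓝 0)) :
    ∃ ns : ℕ → ℕ, StrictMono ns ∧ ∀ᵐ x ∂μ, Tendsto (fun k => f (ns k) x) atTop (𝓝 (g x)) :=
  (tendstoInMeasure_of_tendsto_eLpNorm two_ne_zero (fun n => (hf n).aestronglyMeasurable)
    hg.aestronglyMeasurable
    (tendsto_eLpNorm_two (Eventually.of_forall hf) hg hfg)).exists_seq_tendsto_ae

/-- Fatou's lemma for Bochner integrals of nonnegative functions. -/
theorem integrable_of_tendsto_ae_of_integral_le {c : ℝ} (hf : ∀ n, Integrable (f n) μ)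
    (h0 : ∀ n, 0 ≤ᵐ[μ] f n) (hc : ∀ n, ∫ x, f n x ∂μ ≤ c)
    (hfg : ∀ᵐ x ∂μ, Tendsto (fun n => f n x) atTop (𝓝 (g x))) :
    Integrable g μ ∧ ∫ x, g x ∂μ ≤ c := by
  have hgm : AEStronglyMeasurable g μ :=
    aestronglyMeasurable_of_tendsto_ae atTop (fun n => (hf n).aestronglyMeasurable) hfg
  have hg0 : 0 ≤ᵐ[μ] g := by
    filter_upwards [hfg, ae_all_iff.2 h0] with x hx hx0 using ge_of_tendsto' hx hx0
  have hle : ∫⁻ x, ENNReal.ofReal (g x) ∂μ ≤ ENNReal.ofReal c :=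
    calc ∫⁻ x, ENNReal.ofReal (g x) ∂μ
        = ∫⁻ x, liminf (fun n => ENNReal.ofReal (f n x)) atTop ∂μ := by
          refine lintegral_congr_ae ?_
          filter_upwards [hfg] with x hx
          exact (ENNReal.tendsto_ofReal hx).liminf_eq.symm
      _ ≤ liminf (fun n => ∫⁻ x, ENNReal.ofReal (f n x) ∂μ) atTop :=
          lintegral_liminf_le' fun n => (hf n).aestronglyMeasurable.aemeasurable.ennreal_ofReal
      _ ≤ ENNReal.ofReal c := by
          refine liminf_le_of_le (by isBoundedDefault) fun b hb => ?_
          obtain ⟨n, hn⟩ := hb.exists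
          refine hn.trans ?_
          rw [← ofReal_integral_eq_lintegral_ofReal (hf n) (h0 n)]
          exact ENNReal.ofReal_le_ofReal (hc n)
  have hc0 : 0 ≤ c := (integral_nonneg_of_ae (h0 0)).trans (hc 0)
  refine ⟨⟨hgm, ?_⟩, ?_⟩
  · rw [hasFiniteIntegral_iff_ofReal hg0]
    exact hle.trans_lt ENNReal.ofReal_lt_top
  · rw [integral_eq_lintegral_of_nonneg_ae hg0 hgm]
    exact ENNReal.toReal_le_of_le_ofReal hc0 hle

end SquareIntegrableLimits

/-! ### Closedness of weak derivatives and conservation of mass -/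

section Compactness

variable {d : ℕ} {γ : Fin d → ℝ}

/-- Test functions and their derivatives are in `L²`, so both sides of the defining identity pass to
the limit. -/
theorem HasWeakPartial.of_tendsto {i : Fin d} {f g : ℕ → Space d → ℝ} {f₀ g₀ : Space d → ℝ}
    (h : ∀ n, HasWeakPartial i (f n) (g n)) (hf : ∀ n, MemLp (f n) 2 volume)
    (hg : ∀ n, MemLp (g n) 2 volume) (hf₀ : MemLp f₀ 2 volume) (hg₀ : MemLp g₀ 2 volume)
    (hff : Tendsto (fun n => ∫ x, (f n x - f₀ x) ^ 2) atTop (𝓝 0))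
    (hgg : Tendsto (fun n => ∫ x, (g n x - g₀ x) ^ 2) atTop (𝓝 0)) :
    HasWeakPartial i f₀ g₀ := by
  refine ⟨hf₀.locallyIntegrable (by norm_num), hg₀.locallyIntegrable (by norm_num),
    fun η hη hc => ?_⟩
  have h1 : MemLp η 2 volume := hη.continuous.memLp_of_hasCompactSupport hc
  have h2 : MemLp (fun x => fderiv ℝ η x (EuclideanSpace.single i 1)) 2 volume :=
    (continuous_fderiv_single hη i).memLp_of_hasCompactSupport (hasCompactSupport_fderiv_single hc i)
  have t1 := tendsto_integral_mul hf hf₀ h2 hff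
  have t2 := (tendsto_integral_mul hg hg₀ h1 hgg).neg
  refine tendsto_nhds_unique t1 (t2.congr fun n => ?_)
  simpa using ((h n).2.2 η hη hc).symm

/-- The confinement controls the mass at infinity. -/
theorem integral_abs_le_of_confinement {c : ℝ} (hc : 0 < c)
    (hV : ∀ x, c * ‖x‖ ^ 2 ≤ harmonicPotential γ x) {f : Space d → ℝ}
    (hf : Integrable f volume) (hf2 : MemLp f 2 volume)
    (hVf : Integrable (fun x => harmonicPotential γ x * |f x|) volume) {R : ℝ} (hR : 0 < R) :
    ∫ x, |f x| ≤ √(volume.real (Metric.ball (0 : Space d) R) * ∫ x, f x ^ 2)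
      + (c * R ^ 2)⁻¹ * ∫ x, harmonicPotential γ x * |f x| := by
  set S := Metric.ball (0 : Space d) R
  have hS : MeasurableSet S := measurableSet_ball
  rw [← integral_add_compl hS hf.abs, ← integral_const_mul (c * R ^ 2)⁻¹]
  refine add_le_add ?_ ?_
  -- Inside the ball: Cauchy–Schwarz against the constant `1`.
  · refine Real.le_sqrt_of_sq_le ?_
    have : IsFiniteMeasure (volume.restrict S) := ⟨by simpa using measure_ball_lt_top⟩
    have h1 := sq_integral_mul_le (memLp_const (1 : ℝ)) (hf2.restrict S).abs
    simp only [one_mul, one_pow, Pi.abs_apply, sq_abs, integral_const, smul_eq_mul, mul_one,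
      measureReal_restrict_apply_univ] at h1
    exact h1.trans (mul_le_mul_of_nonneg_left (setIntegral_le_integral hf2.integrable_sq
      (Eventually.of_forall fun x => sq_nonneg _)) measureReal_nonneg)
  -- Outside the ball: Chebyshev, since `V ≥ c R²` there.
  · refine le_trans (setIntegral_mono_on hf.abs.integrableOn
      (hVf.const_mul (c * R ^ 2)⁻¹).integrableOn hS.compl fun x hx => ?_)
      (setIntegral_le_integral (hVf.const_mul _) (Eventually.of_forall fun x => ?_))
    · have hx' : R ≤ ‖x‖ := by simpa [S] using hx
      have h1 : c * R ^ 2 ≤ harmonicPotential γ x :=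
        (mul_le_mul_of_nonneg_left (pow_le_pow_left₀ hR.le hx' 2) hc.le).trans (hV x)
      have h2 : 0 < c * R ^ 2 := by positivity
      rw [← mul_assoc, inv_mul_eq_div]
      exact le_mul_of_one_le_left (abs_nonneg _) ((one_le_div h2).2 h1)
    · have := harmonicPotential_nonneg γ x
      simp only [Pi.zero_apply]
      positivity

/-- Limits of trapped densities in `L²` are trapped. -/
theorem IsTrappedDensity.of_tendsto (hγ : ∀ i, 0 < γ i) {ρ : ℕ → Space d → ℝ} {ρ₀ : Space d → ℝ}
    (hρ : ∀ n, IsTrappedDensity (harmonicPotential γ) (ρ n)) (hρ2 : ∀ n, MemLp (ρ n) 2 volume)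
    (hρ₀ : MemLp ρ₀ 2 volume)
    (hlim : Tendsto (fun n => ∫ x, (ρ n x - ρ₀ x) ^ 2) atTop (𝓝 0)) {a : ℝ}
    (ha : Tendsto (fun n => ∫ x, harmonicPotential γ x * ρ n x) atTop (𝓝 a)) :
    IsTrappedDensity (harmonicPotential γ) ρ₀ ∧ ∫ x, harmonicPotential γ x * ρ₀ x ≤ a := by
  obtain ⟨ns, hns, hae⟩ := exists_subseq_tendsto_ae hρ2 hρ₀ hlim
  have hpos : 0 ≤ᵐ[volume] ρ₀ := by
    filter_upwards [hae, ae_all_iff.2 fun n => (hρ n).nonneg] with x hx hx0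
    exact ge_of_tendsto' hx fun k => hx0 (ns k)
  -- Fatou gives integrability and only mass at most `1`; that no mass escapes is shown below with
  -- the trap.
  have hi : Integrable ρ₀ volume := (integrable_of_tendsto_ae_of_integral_le (c := 1)
    (fun k => (hρ (ns k)).integrable) (fun k => (hρ (ns k)).nonneg)
    (fun k => (hρ (ns k)).integral_eq_one.le) hae).1
  have hVpos : ∀ n, 0 ≤ᵐ[volume] fun x => harmonicPotential γ x * ρ n x := fun n => by
    filter_upwards [(hρ n).nonneg] with x hx using mul_nonneg (harmonicPotential_nonneg γ x) hx
  have hV : ∀ c, a < c → Integrable (fun x => harmonicPotential γ x * ρ₀ x) volume ∧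
      ∫ x, harmonicPotential γ x * ρ₀ x ≤ c := fun c hc => by
    obtain ⟨N, hN⟩ := eventually_atTop.1 ((ha.comp hns.tendsto_atTop).eventually_le_const hc)
    refine integrable_of_tendsto_ae_of_integral_le
      (f := fun k x => harmonicPotential γ x * ρ (ns (k + N)) x)
      (fun k => (hρ _).integrable_mul) (fun k => hVpos _) (fun k => hN _ (by omega)) ?_
    filter_upwards [hae] with x hx
    exact ((tendsto_add_atTop_iff_nat N).2 hx).const_mul _
  have hVi := (hV (a + 1) (by linarith)).1
  have hVa : ∫ x, harmonicPotential γ x * ρ₀ x ≤ a := le_of_forall_gt_imp_ge_of_dense fun c hc =>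
    (hV c hc).2
  obtain ⟨c, hc, hcV⟩ := exists_le_harmonicPotential hγ
  have hbd : ∀ n, ∫ x, harmonicPotential γ x * |ρ n x - ρ₀ x|
      ≤ (∫ x, harmonicPotential γ x * ρ n x) + ∫ x, harmonicPotential γ x * ρ₀ x := fun n => by
    rw [← integral_add (hρ n).integrable_mul hVi]
    refine integral_mono_of_nonneg (Eventually.of_forall fun x =>
      mul_nonneg (harmonicPotential_nonneg γ x) (abs_nonneg _)) ((hρ n).integrable_mul.add hVi) ?_
    filter_upwards [(hρ n).nonneg, hpos] with x hx hx0
    simp only [Pi.zero_apply] at hx hx0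
    rw [← mul_add]
    refine mul_le_mul_of_nonneg_left ?_ (harmonicPotential_nonneg γ x)
    rw [abs_le]
    constructor <;> linarith
  have hVi' : ∀ n, Integrable (fun x => harmonicPotential γ x * |ρ n x - ρ₀ x|) volume := fun n => by
    refine ((hρ n).integrable_mul.sub hVi).abs.congr (Eventually.of_forall fun x => ?_)
    simp only [Pi.sub_apply]
    rw [← mul_sub, abs_mul, abs_of_nonneg (harmonicPotential_nonneg γ x)]
  -- For fixed `R`, `L²` convergence removes the defect inside the ball as `n → ∞`; the tail is then
  -- made small by letting `R → ∞`.
  have hmass : ∀ R : ℝ, 0 < R → |1 - ∫ x, ρ₀ x| ≤ (c * R ^ 2)⁻¹ * (a + a) := fun R hR => by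
    have hlim' : Tendsto (fun n => √(volume.real (Metric.ball (0 : Space d) R)
          * ∫ x, (ρ n x - ρ₀ x) ^ 2)
        + (c * R ^ 2)⁻¹ * ((∫ x, harmonicPotential γ x * ρ n x) + a)) atTop
        (𝓝 (0 + (c * R ^ 2)⁻¹ * (a + a))) := by
      exact (tendsto_sqrt_const_mul hlim _).add ((ha.add_const a).const_mul _)
    rw [zero_add] at hlim'
    refine ge_of_tendsto' hlim' fun n => ?_
    have e : 1 - ∫ x, ρ₀ x = ∫ x, (ρ n x - ρ₀ x) := by
      rw [integral_sub (hρ n).integrable hi, (hρ n).integral_eq_one]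
    rw [e]
    refine abs_integral_le_integral_abs.trans ((integral_abs_le_of_confinement hc hcV
      ((hρ n).integrable.sub hi) ((hρ2 n).sub hρ₀) (hVi' n) hR).trans ?_)
    refine add_le_add le_rfl (mul_le_mul_of_nonneg_left ?_ (by positivity))
    simp only [Pi.sub_apply]
    linarith [hbd n]
  have h0 : |1 - ∫ x, ρ₀ x| ≤ 0 := by
    have t : Tendsto (fun R : ℝ => (c * R ^ 2)⁻¹ * (a + a)) atTop (𝓝 (0 * (a + a))) :=
      ((tendsto_inv_atTop_zero.comp
        ((tendsto_pow_atTop two_ne_zero).const_mul_atTop hc))).mul_const _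
    rw [zero_mul] at t
    exact ge_of_tendsto t ((eventually_gt_atTop 0).mono hmass)
  have h1 := abs_nonpos_iff.1 h0
  exact ⟨⟨hi, hpos, by linarith, hVi⟩, hVa⟩

end Compactness

/-! ### Convexity and minimizers of the density energy -/

section Variational

variable {d : ℕ} {γ : Fin d → ℝ} {V ρ σ : Space d → ℝ} {b c : ℝ}

/-- The energy `∫ (Vρ + (b/2) ρ² + (c/2) |∇ρ|²)` as a function of the density. -/
noncomputable def densityEnergy (V : Space d → ℝ) (b c : ℝ) (ρ : Space d → ℝ) : ℝ :=
  (∫ x, V x * ρ x) + b / 2 * (∫ x, ρ x ^ 2) + c / 2 * ∫ x, gradSq ρ x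

/-- Trapped densities with square integrable weak gradient. -/
def sobolevDensities (V : Space d → ℝ) : Set (Space d → ℝ) :=
  {ρ | IsTrappedDensity V ρ ∧ HasL2WeakGrad ρ}

theorem memLp_two_of_mem_sobolevDensities (h : ρ ∈ sobolevDensities V) : MemLp ρ 2 volume := by
  obtain ⟨M, B, -, -, hN⟩ := exists_nash_constants d
  exact (hN 1 one_pos ρ h.1.integrable h.2).1

theorem IsTrappedDensity.midpoint (h : IsTrappedDensity V ρ) (h' : IsTrappedDensity V σ) :
    IsTrappedDensity V ((1 / 2 : ℝ) • (ρ + σ)) := by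
  refine ⟨(h.integrable.add h'.integrable).smul _, ?_, ?_, ?_⟩
  · filter_upwards [h.nonneg, h'.nonneg] with x hx hx'
    simp only [Pi.zero_apply, Pi.smul_apply, Pi.add_apply, smul_eq_mul] at *
    positivity
  · simp only [Pi.smul_apply, Pi.add_apply, smul_eq_mul]
    rw [integral_const_mul, integral_add h.integrable h'.integrable, h.integral_eq_one,
      h'.integral_eq_one]
    norm_num
  · refine ((h.integrable_mul.add h'.integrable_mul).const_mul (1 / 2)).congr
      (Eventually.of_forall fun x => ?_)
    simp only [Pi.smul_apply, Pi.add_apply, smul_eq_mul]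
    ring

theorem integral_norm_sq_midpoint {α : Type*} [MeasurableSpace α] {μ : Measure α} {f g : α → ℝ}
    (hf : MemLp f 2 μ) (hg : MemLp g 2 μ) :
    ∫ x, ((1 / 2) * (f x + g x)) ^ 2 ∂μ = (1 / 2) * (∫ x, f x ^ 2 ∂μ) + (1 / 2) * (∫ x, g x ^ 2 ∂μ)
      - (1 / 4) * ∫ x, (f x - g x) ^ 2 ∂μ := by
  have hs : Integrable (fun x => (f x - g x) ^ 2) μ := (hf.sub hg).integrable_sq
  have h1 : Integrable (fun x => (1 / 2) * f x ^ 2 + (1 / 2) * g x ^ 2) μ :=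
    (hf.integrable_sq.const_mul _).add (hg.integrable_sq.const_mul _)
  rw [← integral_const_mul, ← integral_const_mul, ← integral_const_mul,
    ← integral_add (hf.integrable_sq.const_mul _) (hg.integrable_sq.const_mul _),
    ← integral_sub h1 (hs.const_mul _)]
  congr 1
  ext x
  ring

theorem integral_gradSq_real (h : HasL2WeakGrad ρ) :
    ∫ x, gradSq ρ x = ∑ i, ∫ x, weakPartial i ρ x ^ 2 := by
  simp [h.integral_gradSq]

theorem integral_gradSq_of_hasWeakPartial {g : Fin d → Space d → ℝ}
    (h : ∀ i, HasWeakPartial i ρ (g i)) (hg : ∀ i, MemLp (g i) 2 volume) :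
    ∫ x, gradSq ρ x = ∑ i, ∫ x, g i x ^ 2 := by
  rw [integral_congr_ae (gradSq_ae_eq h)]
  simp only [Real.norm_eq_abs, sq_abs]
  exact integral_finsetSum _ fun i _ => (hg i).integrable_sq

theorem integral_gradSq_sub (hρ : HasL2WeakGrad ρ) (hσ : HasL2WeakGrad σ) :
    ∫ x, gradSq (ρ - σ) x = ∑ i, ∫ x, (weakPartial i ρ x - weakPartial i σ x) ^ 2 :=
  integral_gradSq_of_hasWeakPartial
    (fun i => (hρ.hasWeakPartial i).sub (hσ.hasWeakPartial i))
    (fun i => (hρ.memLp i).sub (hσ.memLp i))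

/-- The parallelogram identity for the energy. -/
theorem densityEnergy_midpoint (hρ : ρ ∈ sobolevDensities V) (hσ : σ ∈ sobolevDensities V) :
    (1 / 2 : ℝ) • (ρ + σ) ∈ sobolevDensities V ∧
    densityEnergy V b c ((1 / 2 : ℝ) • (ρ + σ))
      = (1 / 2) * densityEnergy V b c ρ + (1 / 2) * densityEnergy V b c σ
        - (1 / 4) * (b / 2 * (∫ x, (ρ x - σ x) ^ 2) + c / 2 * ∫ x, gradSq (ρ - σ) x) := by
  refine ⟨⟨hρ.1.midpoint hσ.1, (hρ.2.add hσ.2).const_smul _⟩, ?_⟩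
  have hw : ∀ i, HasWeakPartial i ((1 / 2 : ℝ) • (ρ + σ))
      (fun x => (1 / 2) * (weakPartial i ρ x + weakPartial i σ x)) := fun i =>
    ((hρ.2.hasWeakPartial i).add (hσ.2.hasWeakPartial i)).const_smul (1 / 2)
  have hw2 : ∀ i, MemLp (fun x => (1 / 2) * (weakPartial i ρ x + weakPartial i σ x)) 2 volume :=
    fun i => ((hρ.2.memLp i).add (hσ.2.memLp i)).const_mul (1 / 2)
  have e1 : ∫ x, V x * ((1 / 2 : ℝ) • (ρ + σ)) x
      = (1 / 2) * (∫ x, V x * ρ x) + (1 / 2) * ∫ x, V x * σ x := by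
    rw [← integral_const_mul, ← integral_const_mul,
      ← integral_add (hρ.1.integrable_mul.const_mul _) (hσ.1.integrable_mul.const_mul _)]
    congr 1
    ext x
    simp only [Pi.smul_apply, Pi.add_apply, smul_eq_mul]
    ring
  have e2 := integral_norm_sq_midpoint (memLp_two_of_mem_sobolevDensities hρ)
    (memLp_two_of_mem_sobolevDensities hσ)
  simp only [densityEnergy, e1]
  rw [integral_gradSq_of_hasWeakPartial hw hw2, integral_gradSq_sub hρ.2 hσ.2,
    integral_gradSq_real hρ.2, integral_gradSq_real hσ.2]
  simp only [Pi.smul_apply, Pi.add_apply, smul_eq_mul, e2,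
    integral_norm_sq_midpoint (hρ.2.memLp _) (hσ.2.memLp _), Finset.sum_add_distrib,
    Finset.sum_sub_distrib, ← Finset.mul_sum]
  ring

theorem integral_abs_sub_le (hρ : IsTrappedDensity V ρ) (hσ : IsTrappedDensity V σ) :
    ∫ x, |(ρ - σ) x| ≤ 2 := by
  calc ∫ x, |(ρ - σ) x| ≤ ∫ x, (ρ x + σ x) := by
        refine integral_mono_ae (hρ.integrable.sub hσ.integrable).abs
          (hρ.integrable.add hσ.integrable) ?_
        filter_upwards [hρ.nonneg, hσ.nonneg] with x hx hx'
        simp only [Pi.zero_apply, Pi.sub_apply] at *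
        rw [abs_le]
        constructor <;> linarith
    _ = 2 := by
        rw [integral_add hρ.integrable hσ.integrable, hρ.integral_eq_one, hσ.integral_eq_one]
        norm_num

/-- Near minimizers of the energy are close to each other. -/
theorem near_minimizers_close (hd : 1 ≤ d) (hb : 0 ≤ b) (hc : 0 < c) {ε : ℝ} (hε : 0 < ε) :
    ∃ η > 0, ∀ m : ℝ, (∀ σ ∈ sobolevDensities V, m ≤ densityEnergy V b c σ) →
      ∀ ρ ∈ sobolevDensities V, ∀ σ ∈ sobolevDensities V,
        densityEnergy V b c ρ ≤ m + η → densityEnergy V b c σ ≤ m + η →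
          ∫ x, (ρ x - σ x) ^ 2 ≤ ε ∧ ∫ x, gradSq (ρ - σ) x ≤ ε := by
  obtain ⟨M, B, hM, hB, hN⟩ := exists_nash_constants d
  -- Two densities differ by at most `2` in `L¹`, so the mass term of the Nash inequality is at most
  -- `4 B s^(-d)`; it is small for large `s` because `d ≥ 1`. The `L²` bound cannot come from the
  -- `ρ²` term, as `b` may be `0`.
  obtain ⟨s, hs, hsB⟩ : ∃ s : ℝ, 0 < s ∧ B * (s ^ d)⁻¹ * 4 ≤ ε / 2 := by
    have t : Tendsto (fun s : ℝ => B * (s ^ d)⁻¹ * 4) atTop (𝓝 (B * 0 * 4)) :=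
      ((tendsto_inv_atTop_zero.comp (tendsto_pow_atTop (by omega))).const_mul B).mul_const 4
    rw [mul_zero, zero_mul] at t
    obtain ⟨s, hs1, hs2⟩ := ((eventually_gt_atTop 0).and (t.eventually_le_const (half_pos hε))).exists
    exact ⟨s, hs1, hs2⟩
  have hMs : 0 < M * s ^ 2 + 1 := by positivity
  -- A gradient bound `τ` suffices both for the second claim and for the gradient term of the Nash
  -- inequality at this `s`.
  set τ := min ε (ε / 2 / (M * s ^ 2 + 1))
  have hτ : 0 < τ := lt_min hε (by positivity)
  -- The midpoint has energy at least `m`, so the parallelogram defect, which is at least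
  -- `(c/8)∫|∇(ρ - σ)|²`, is at most `η`.
  refine ⟨c * τ / 8, by positivity, fun m hm ρ hρ σ hσ h1 h2 => ?_⟩
  obtain ⟨hmem, hmid⟩ := densityEnergy_midpoint (b := b) (c := c) hρ hσ
  have hle := hm _ hmem
  have h3 : 0 ≤ b / 2 * ∫ x, (ρ x - σ x) ^ 2 :=
    mul_nonneg (by positivity) (integral_nonneg fun x => sq_nonneg _)
  have hg0 : 0 ≤ ∫ x, gradSq (ρ - σ) x := integral_nonneg (gradSq_nonneg _)
  have h4 : c * ∫ x, gradSq (ρ - σ) x ≤ c * τ := by linarith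
  have h5 : ∫ x, gradSq (ρ - σ) x ≤ τ := le_of_mul_le_mul_left h4 hc
  refine ⟨?_, h5.trans (min_le_left _ _)⟩
  refine (hN s hs _ (hρ.1.integrable.sub hσ.1.integrable) (hρ.2.sub hσ.2)).2.trans ?_
  have h6 : M * s ^ 2 * ∫ x, gradSq (ρ - σ) x ≤ ε / 2 := by
    have h7 := (le_div_iff₀ hMs).1 (h5.trans (min_le_right _ _))
    nlinarith
  have h8 : (∫ x, |(ρ - σ) x|) ^ 2 ≤ 4 := by
    have := integral_abs_sub_le hρ.1 hσ.1
    have : 0 ≤ ∫ x, |(ρ - σ) x| := integral_nonneg fun x => abs_nonneg _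
    nlinarith
  have h9 : B * (s ^ d)⁻¹ * (∫ x, |(ρ - σ) x|) ^ 2 ≤ B * (s ^ d)⁻¹ * 4 := by gcongr
  linarith

theorem sobolevDensities_nonempty (γ : Fin d → ℝ) :
    (sobolevDensities (harmonicPotential γ)).Nonempty := by
  obtain ⟨K, hK⟩ := exists_isSmoothingKernel d
  have : IsTrappedDensity (harmonicPotential γ) K :=
    ⟨hK.integrable, Eventually.of_forall fun x => (hK.pos x).le, hK.integral_eq_one, by
      simpa [mul_comm] using hK.integrable_harmonicPotential_mul γ⟩
  obtain ⟨φ, hφ, -⟩ := this.exists_mem_stateSet one_pos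
  exact ⟨density φ, hφ.1.isTrappedDensity, hφ.2.2.2⟩

theorem densityEnergy_nonneg (hb : 0 ≤ b) (hc : 0 ≤ c)
    (hρ : IsTrappedDensity (harmonicPotential γ) ρ) :
    0 ≤ densityEnergy (harmonicPotential γ) b c ρ := by
  have h1 : 0 ≤ ∫ x, harmonicPotential γ x * ρ x := by
    refine integral_nonneg_of_ae ?_
    filter_upwards [hρ.nonneg] with x hx using mul_nonneg (harmonicPotential_nonneg γ x) hx
  have h2 : 0 ≤ ∫ x, ρ x ^ 2 := integral_nonneg fun x => sq_nonneg _
  have h3 : 0 ≤ ∫ x, gradSq ρ x := integral_nonneg (gradSq_nonneg _)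
  unfold densityEnergy
  positivity

/-- The energy has a minimizer among trapped Sobolev densities. -/
theorem exists_minimizer (hd : 1 ≤ d) (hγ : ∀ i, 0 < γ i) (hb : 0 ≤ b) (hc : 0 < c) :
    ∃ ρ₀ ∈ sobolevDensities (harmonicPotential γ), ∀ σ ∈ sobolevDensities (harmonicPotential γ),
      densityEnergy (harmonicPotential γ) b c ρ₀ ≤ densityEnergy (harmonicPotential γ) b c σ := by
  set V := harmonicPotential γ
  set A := densityEnergy V b c '' sobolevDensities V
  have hA : BddBelow A := ⟨0, by
    rintro _ ⟨σ, hσ, rfl⟩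
    exact densityEnergy_nonneg hb hc.le hσ.1⟩
  set m := sInf A
  have hm : ∀ σ ∈ sobolevDensities V, m ≤ densityEnergy V b c σ := fun σ hσ =>
    csInf_le hA ⟨σ, hσ, rfl⟩
  have hseq : ∀ n : ℕ, ∃ ρ ∈ sobolevDensities V, densityEnergy V b c ρ < m + 1 / (n + 1) := by
    intro n
    obtain ⟨_, ⟨ρ, hρ, rfl⟩, h⟩ := exists_lt_of_csInf_lt
      ((sobolevDensities_nonempty γ).image (densityEnergy V b c))
      (lt_add_of_pos_right m (Nat.one_div_pos_of_nat (α := ℝ) (n := n)))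
    exact ⟨ρ, hρ, h⟩
  choose ρ hρ hρm using hseq
  have hρ2 := fun n => memLp_two_of_mem_sobolevDensities (hρ n)
  have hEm : Tendsto (fun n => densityEnergy V b c (ρ n)) atTop (𝓝 m) := by
    refine tendsto_of_tendsto_of_tendsto_of_le_of_le tendsto_const_nhds ?_ (fun n => hm _ (hρ n))
      fun n => (hρm n).le
    simpa using tendsto_one_div_add_atTop_nhds_zero_nat.const_add m
  -- Strict convexity replaces a compactness argument: the whole minimizing sequence is Cauchy.
  have hcauchy : ∀ ε > 0, ∃ N, ∀ p ≥ N, ∀ n ≥ N,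
      ∫ x, (ρ p x - ρ n x) ^ 2 ≤ ε ∧ ∫ x, gradSq (ρ p - ρ n) x ≤ ε := fun ε hε => by
    obtain ⟨η, hη, h⟩ := near_minimizers_close (V := V) hd hb hc hε
    obtain ⟨N, hN⟩ := eventually_atTop.1
      (hEm.eventually_le_const (lt_add_of_pos_right m hη))
    exact ⟨N, fun p hp n hn => h m hm _ (hρ p) _ (hρ n) (hN p hp) (hN n hn)⟩
  obtain ⟨ρ₀, hρ₀, hlim⟩ := exists_tendsto_of_cauchy hρ2 fun ε hε => by
    obtain ⟨N, hN⟩ := hcauchy ε hε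
    exact ⟨N, fun p hp n hn => (hN p hp n hn).1⟩
  have hg : ∀ i, ∃ g, MemLp g 2 volume ∧
      Tendsto (fun n => ∫ x, (weakPartial i (ρ n) x - g x) ^ 2) atTop (𝓝 0) := fun i =>
    exists_tendsto_of_cauchy (fun n => (hρ n).2.memLp i) fun ε hε => by
      obtain ⟨N, hN⟩ := hcauchy ε hε
      refine ⟨N, fun p hp n hn => le_trans ?_ (hN p hp n hn).2⟩
      rw [integral_gradSq_sub (hρ p).2 (hρ n).2]
      exact Finset.single_le_sum
        (f := fun i => ∫ x, (weakPartial i (ρ p) x - weakPartial i (ρ n) x) ^ 2)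
        (fun j _ => integral_nonneg fun x => sq_nonneg _) (Finset.mem_univ i)
  choose g hg2 hglim using hg
  have hw : ∀ i, HasWeakPartial i ρ₀ (g i) := fun i =>
    HasWeakPartial.of_tendsto (fun n => (hρ n).2.hasWeakPartial i) hρ2
      (fun n => (hρ n).2.memLp i) hρ₀ (hg2 i) hlim (hglim i)
  have ht1 := tendsto_integral_sq hρ2 hρ₀ hlim
  have ht2 : Tendsto (fun n => ∫ x, gradSq (ρ n) x) atTop (𝓝 (∫ x, gradSq ρ₀ x)) := by
    rw [integral_gradSq_of_hasWeakPartial hw hg2]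
    simp only [integral_gradSq_real (hρ _).2]
    exact tendsto_finsetSum _ fun i _ =>
      tendsto_integral_sq (fun n => (hρ n).2.memLp i) (hg2 i) (hglim i)
  -- The total energy and both quadratic parts converge, so the potential energy does too; Fatou
  -- will bound that of `ρ₀` by this limit, which gives energy at most `m`.
  have htV : Tendsto (fun n => ∫ x, V x * ρ n x) atTop
      (𝓝 (m - (b / 2 * ∫ x, ρ₀ x ^ 2) - c / 2 * ∫ x, gradSq ρ₀ x)) := by
    refine ((hEm.sub (ht1.const_mul (b / 2))).sub (ht2.const_mul (c / 2))).congr fun n => ?_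
    simp only [densityEnergy]
    ring
  obtain ⟨htr, hVle⟩ := IsTrappedDensity.of_tendsto hγ (fun n => (hρ n).1) hρ2 hρ₀ hlim htV
  refine ⟨ρ₀, ⟨htr, fun i => ⟨g i, hw i, hg2 i⟩⟩, fun σ hσ => le_trans ?_ (hm σ hσ)⟩
  unfold densityEnergy
  linarith

end Variational

/-! ### The Thomas–Fermi profile -/

section ThomasFermi

variable {d : ℕ} {γ : Fin d → ℝ} {μ : ℝ}

/-- The Thomas–Fermi profile `max (μ - V) 0`. -/
noncomputable def thomasFermi (γ : Fin d → ℝ) (μ : ℝ) (x : Space d) : ℝ :=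
  max (μ - harmonicPotential γ x) 0

theorem continuous_thomasFermi (γ : Fin d → ℝ) (μ : ℝ) : Continuous (thomasFermi γ μ) :=
  (continuous_const.sub (continuous_harmonicPotential γ)).max continuous_const

theorem thomasFermi_nonneg (γ : Fin d → ℝ) (μ : ℝ) (x : Space d) : 0 ≤ thomasFermi γ μ x :=
  le_max_right _ _

theorem hasCompactSupport_thomasFermi (hγ : ∀ i, 0 < γ i) (μ : ℝ) :
    HasCompactSupport (thomasFermi γ μ) := by
  obtain ⟨c, hc, hle⟩ := exists_le_harmonicPotential hγ
  refine HasCompactSupport.intro (isCompact_closedBall (0 : Space d) √(μ / c)) fun x hx => ?_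
  rw [mem_closedBall_zero_iff, not_le] at hx
  have h1 : μ / c < ‖x‖ ^ 2 := (Real.sqrt_lt' ((Real.sqrt_nonneg _).trans_lt hx)).1 hx
  rw [div_lt_iff₀ hc] at h1
  exact max_eq_right (by linarith [hle x])

theorem integrable_thomasFermi (hγ : ∀ i, 0 < γ i) (μ : ℝ) :
    Integrable (thomasFermi γ μ) volume :=
  (continuous_thomasFermi γ μ).integrable_of_hasCompactSupport (hasCompactSupport_thomasFermi hγ μ)

theorem memLp_thomasFermi (hγ : ∀ i, 0 < γ i) (μ : ℝ) : MemLp (thomasFermi γ μ) 2 volume :=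
  (continuous_thomasFermi γ μ).memLp_of_hasCompactSupport (hasCompactSupport_thomasFermi hγ μ)

theorem exists_integral_thomasFermi_eq_one (hγ : ∀ i, 0 < γ i) :
    ∃ μ, ∫ x, thomasFermi γ μ x = 1 := by
  have hI : 0 < ∫ x, thomasFermi γ 1 x := by
    refine (continuous_thomasFermi γ 1).integral_pos_of_hasCompactSupport_nonneg_nonzero
      (hasCompactSupport_thomasFermi hγ 1) (thomasFermi_nonneg γ 1) (x := 0) ?_
    simp [thomasFermi, harmonicPotential]
  set I := ∫ x, thomasFermi γ 1 x
  -- Since `V` is homogeneous of degree `2`, the profile for `t²` is `t²` times the dilated profile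
  -- for `1`, with mass `t^(d+2) I`.
  set t := (I⁻¹) ^ (((d + 2 : ℕ) : ℝ)⁻¹)
  have ht : 0 < t := Real.rpow_pos_of_pos (inv_pos.2 hI) _
  have htd : t ^ (d + 2) = I⁻¹ := Real.rpow_inv_natCast_pow (inv_pos.2 hI).le (by omega)
  refine ⟨t ^ 2, ?_⟩
  have h1 : ∀ x, thomasFermi γ (t ^ 2) x = t ^ 2 * thomasFermi γ 1 (t⁻¹ • x) := fun x => by
    rw [thomasFermi, thomasFermi, harmonicPotential_smul, mul_max_of_nonneg _ _ (sq_nonneg t),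
      mul_zero, mul_sub, mul_one, inv_pow, mul_inv_cancel_left₀ (by positivity)]
  simp_rw [h1]
  rw [integral_const_mul, Measure.integral_comp_smul, finrank_euclideanSpace_fin, smul_eq_mul,
    ← mul_assoc, inv_pow, inv_inv, abs_of_pos (pow_pos ht d), ← pow_add, add_comm, htd]
  exact inv_mul_cancel₀ hI.ne'

theorem isTrappedDensity_thomasFermi (hγ : ∀ i, 0 < γ i) (h1 : ∫ x, thomasFermi γ μ x = 1) :
    IsTrappedDensity (harmonicPotential γ) (thomasFermi γ μ) :=
  ⟨integrable_thomasFermi hγ μ, Eventually.of_forall (thomasFermi_nonneg γ μ), h1,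
    ((continuous_harmonicPotential γ).mul (continuous_thomasFermi γ μ)).integrable_of_hasCompactSupport
      (hasCompactSupport_thomasFermi hγ μ).mul_left⟩

/-- The Thomas–Fermi profile minimizes the energy, with a quantitative lower bound. -/
theorem densityEnergy_thomasFermi_add_le (hγ : ∀ i, 0 < γ i) (h1 : ∫ x, thomasFermi γ μ x = 1)
    {σ : Space d → ℝ} (hσ : IsTrappedDensity (harmonicPotential γ) σ) (hσ2 : MemLp σ 2 volume) :
    densityEnergy (harmonicPotential γ) 1 0 (thomasFermi γ μ)
      + (1 / 2) * ∫ x, (σ x - thomasFermi γ μ x) ^ 2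
      ≤ densityEnergy (harmonicPotential γ) 1 0 σ := by
  have hρ := isTrappedDensity_thomasFermi hγ h1
  have hρ2 := memLp_thomasFermi hγ μ
  set ρ := thomasFermi γ μ with hρdef
  have i1 : Integrable (fun x => (1 / 2) * (σ x - ρ x) ^ 2) volume :=
    (hσ2.sub hρ2).integrable_sq.const_mul _
  have i2 : Integrable (fun x => μ * (σ x - ρ x)) volume :=
    (hσ.integrable.sub hρ.integrable).const_mul μ
  have i3 : ∀ {τ : Space d → ℝ}, IsTrappedDensity (harmonicPotential γ) τ → MemLp τ 2 volume →
      Integrable (fun x => harmonicPotential γ x * τ x + (1 / 2) * τ x ^ 2) volume ∧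
      densityEnergy (harmonicPotential γ) 1 0 τ
        = ∫ x, (harmonicPotential γ x * τ x + (1 / 2) * τ x ^ 2) := fun hτ hτ2 => by
    refine ⟨hτ.integrable_mul.add (hτ2.integrable_sq.const_mul _), ?_⟩
    rw [integral_add hτ.integrable_mul (hτ2.integrable_sq.const_mul _), integral_const_mul]
    simp [densityEnergy]
  have i4 : Integrable (fun x => (1 / 2) * (σ x - ρ x) ^ 2 + μ * (σ x - ρ x)) volume := i1.add i2
  have e : ∫ x, ((1 / 2) * (σ x - ρ x) ^ 2 + μ * (σ x - ρ x))
      = (1 / 2) * ∫ x, (σ x - ρ x) ^ 2 := by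
    rw [integral_add i1 i2, integral_const_mul, integral_const_mul,
      integral_sub hσ.integrable hρ.integrable, hσ.integral_eq_one, hρ.integral_eq_one]
    ring
  -- The added term `μ(σ - ρ)` has integral zero, both masses being `1`. With it the inequality
  -- becomes pointwise: the right side minus the left is `(V + ρ - μ)(σ - ρ)`, which is `0` where `ρ
  -- = μ - V` and `(V - μ)σ ≥ 0` where `ρ = 0`.
  rw [(i3 hρ hρ2).2, (i3 hσ hσ2).2, ← e, ← integral_add (i3 hρ hρ2).1 i4]
  refine integral_mono_ae ((i3 hρ hρ2).1.add i4) (i3 hσ hσ2).1 ?_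
  filter_upwards [hσ.nonneg] with x hx
  simp only [Pi.zero_apply, hρdef, thomasFermi] at hx ⊢
  rcases le_total (μ - harmonicPotential γ x) 0 with h | h
  · rw [max_eq_right h]
    nlinarith
  · rw [max_eq_left h]
    nlinarith

/-- Integrate the Euler–Lagrange relation `(V + ρ)ρ = μρ`. -/
theorem thomasFermi_chemical_potential (hγ : ∀ i, 0 < γ i) (h1 : ∫ x, thomasFermi γ μ x = 1) :
    μ = densityEnergy (harmonicPotential γ) 1 0 (thomasFermi γ μ)
      + (1 / 2) * ∫ x, thomasFermi γ μ x ^ 2 := by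
  have hρ := isTrappedDensity_thomasFermi hγ h1
  have hρ2 := memLp_thomasFermi hγ μ
  have e : ∀ x, harmonicPotential γ x * thomasFermi γ μ x + thomasFermi γ μ x ^ 2
      = μ * thomasFermi γ μ x := fun x => by
    simp only [thomasFermi]
    rcases le_total (μ - harmonicPotential γ x) 0 with h | h
    · rw [max_eq_right h]
      ring
    · rw [max_eq_left h]
      ring
  have h2 : ∫ x, (harmonicPotential γ x * thomasFermi γ μ x + thomasFermi γ μ x ^ 2) = μ := by
    simp_rw [e]
    rw [integral_const_mul, h1, mul_one]
  rw [integral_add hρ.integrable_mul hρ2.integrable_sq] at h2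
  simp only [densityEnergy]
  linarith

end ThomasFermi

/-! ### Dilations and the rescaled energy -/

section Rescaling

variable {d : ℕ} {F : Type*} [NormedAddCommGroup F] [NormedSpace ℝ F] {f : Space d → F}

theorem memLp_two_comp_smul {G : Type*} [NormedAddCommGroup G] {f : Space d → G}
    (hf : MemLp f 2 volume) {c : ℝ} (hc : c ≠ 0) :
    MemLp (fun x => f (c • x)) 2 volume := by
  have hm : AEStronglyMeasurable (fun x => f (c • x)) volume :=
    hf.aestronglyMeasurable.comp_quasiMeasurePreserving
      (Measure.quasiMeasurePreserving_smul volume hc)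
  rw [memLp_two_iff_integrable_sq_norm hm]
  exact (integrable_comp_smul_iff volume (fun x => ‖f x‖ ^ 2) hc).2
    ((memLp_two_iff_integrable_sq_norm hf.aestronglyMeasurable).1 hf)

theorem integral_comp_smul_pos (g : Space d → ℝ) {c : ℝ} (hc : 0 < c) :
    ∫ x, g (c • x) = (c ^ d)⁻¹ * ∫ x, g x := by
  rw [Measure.integral_comp_smul, finrank_euclideanSpace_fin, smul_eq_mul,
    abs_of_pos (inv_pos.2 (pow_pos hc d))]

theorem HasL2WeakGrad.dilate [CompleteSpace F] (hf : MemLp f 2 volume) (h : HasL2WeakGrad f)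
    (a : ℝ) {c : ℝ} (hc : 0 < c) :
    HasL2WeakGrad (fun x => a • f (c • x)) ∧
      ∫ x, gradSq (fun x => a • f (c • x)) x = a ^ 2 * c ^ 2 * (c ^ d)⁻¹ * ∫ x, gradSq f x := by
  have hg : ∀ i, MemLp (fun x => weakPartial i f (c • x)) 2 volume := fun i =>
    memLp_two_comp_smul (h.memLp i) hc.ne'
  have hw : ∀ i, HasWeakPartial i (fun x => a • f (c • x))
      (fun x => a • c • weakPartial i f (c • x)) := fun i =>
    ((h.hasWeakPartial i).comp_smul hc.ne'
      ((memLp_two_comp_smul hf hc.ne').locallyIntegrable (by norm_num))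
      ((hg i).locallyIntegrable (by norm_num))).const_smul a
  refine ⟨fun i => ⟨_, hw i, ((hg i).const_smul c).const_smul a⟩, ?_⟩
  rw [integral_congr_ae (gradSq_ae_eq hw)]
  have e : ∀ x, ∑ i, ‖a • c • weakPartial i f (c • x)‖ ^ 2 = a ^ 2 * c ^ 2 * gradSq f (c • x) :=
    fun x => by
      simp only [norm_smul, mul_pow, Real.norm_eq_abs, sq_abs, gradSq, Finset.mul_sum, mul_assoc]
  simp_rw [e]
  rw [integral_const_mul, integral_comp_smul_pos _ hc]
  ring

variable {γ : Fin d → ℝ} {φ : Space d → ℂ}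

theorem rescale_factor_sq {ε : ℝ} (hε : 0 < ε) (d : ℕ) :
    (ε ^ (-(d : ℝ) / 2)) ^ 2 = (ε ^ d)⁻¹ := by
  rw [← Real.rpow_natCast, ← Real.rpow_mul hε.le, ← Real.rpow_natCast, ← Real.rpow_neg hε.le]
  congr 1
  push_cast
  ring

theorem density_rescale {ε : ℝ} (hε : 0 < ε) (φ : Space d → ℂ) :
    density (rescale ε φ) = fun x => (ε ^ d)⁻¹ • density φ (ε⁻¹ • x) := by
  ext x
  rw [density, rescale, norm_smul, mul_pow, Real.norm_eq_abs, sq_abs, rescale_factor_sq hε]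
  rfl

theorem rescale_rescale_inv {ε : ℝ} (hε : 0 < ε) (φ : Space d → ℂ) :
    rescale ε (rescale ε⁻¹ φ) = φ := by
  ext x
  rw [rescale, rescale, smul_smul, smul_smul, inv_inv, mul_inv_cancel₀ hε.ne', one_smul,
    Real.inv_rpow hε.le, mul_inv_cancel₀ (Real.rpow_pos_of_pos hε _).ne', one_smul]

/-- The energy of a state splits into the kinetic energy and the energy of the density. -/
theorem energy_eq {V : Space d → ℝ} (β δ : ℝ) (hφ : φ ∈ stateSet V) :
    energy V β δ φ = (1 / 2) * (∫ x, gradSq φ x) + densityEnergy V β δ (density φ) := by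
  obtain ⟨h1, h2, h3, h4⟩ := hφ
  have i1 := h2.2.integrable_gradSq.const_mul (1 / 2)
  have i2 := h3.integrable_sq.const_mul (β / 2)
  have i3 := h4.integrable_gradSq.const_mul (δ / 2)
  have i4 : Integrable (fun x => (1 / 2) * gradSq φ x + V x * density φ x) volume := i1.add h1.2.2
  have i5 : Integrable (fun x => (1 / 2) * gradSq φ x + V x * density φ x
    + (β / 2) * density φ x ^ 2) volume := i4.add i2
  rw [energy, integral_add i5 i3, integral_add i4 i2, integral_add i1 h1.2.2,
    integral_const_mul, integral_const_mul, integral_const_mul, densityEnergy]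
  ring

/-- Dilation multiplies `∫Vρ` by `ε²`, and the kinetic, quartic and density gradient terms by
`ε^(-2)`, `ε^(-d)` and `ε^(-(d+2))`. The prefactor `ε²` normalizes the potential term and leaves the
kinetic term with weight `ε⁴`. -/
theorem rescale_mem_stateSet {ε : ℝ} (hε : 0 < ε) (β δ : ℝ)
    (hφ : φ ∈ stateSet (harmonicPotential γ)) :
    rescale ε φ ∈ stateSet (harmonicPotential γ) ∧
    ε ^ 2 * energy (harmonicPotential γ) β δ φ
      = ε ^ 4 / 2 * (∫ x, gradSq (rescale ε φ) x)
        + densityEnergy (harmonicPotential γ) (β * ε ^ (d + 2)) (δ * ε ^ (d + 4))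
          (density (rescale ε φ)) := by
  rw [energy_eq β δ hφ]
  obtain ⟨h1, h2, h3, h4⟩ := hφ
  have hc : 0 < ε⁻¹ := inv_pos.2 hε
  have hinv : (ε⁻¹ ^ d)⁻¹ = ε ^ d := by rw [inv_pow, inv_inv]
  obtain ⟨g1, e1⟩ := h2.2.dilate h2.1 (ε ^ (-(d : ℝ) / 2)) hc
  obtain ⟨g2, e2⟩ := h4.dilate h3 (ε ^ d)⁻¹ hc
  have hV : ∀ x, harmonicPotential γ x * ((ε ^ d)⁻¹ • density φ (ε⁻¹ • x))
      = ε ^ 2 * (ε ^ d)⁻¹ * (harmonicPotential γ (ε⁻¹ • x) * density φ (ε⁻¹ • x)) := fun x => by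
    rw [harmonicPotential_smul, smul_eq_mul]
    field_simp
  have eV : ∫ x, harmonicPotential γ x * density (rescale ε φ) x
      = ε ^ 2 * ∫ x, harmonicPotential γ x * density φ x := by
    rw [density_rescale hε]
    simp_rw [hV]
    rw [integral_const_mul,
      integral_comp_smul_pos (fun x => harmonicPotential γ x * density φ x) hc, hinv]
    field_simp
  have eN : ∫ x, density (rescale ε φ) x ^ 2 = (ε ^ d)⁻¹ * ∫ x, density φ x ^ 2 := by
    rw [density_rescale hε]
    simp_rw [smul_eq_mul, mul_pow]
    rw [integral_const_mul, integral_comp_smul_pos (fun x => density φ x ^ 2) hc, hinv]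
    field_simp
  have eI : ∫ x, density (rescale ε φ) x = 1 := by
    rw [density_rescale hε]
    simp_rw [smul_eq_mul]
    rw [integral_const_mul, integral_comp_smul_pos _ hc, h1.2.1, hinv]
    field_simp
  have hφm : MemLp (rescale ε φ) 2 volume :=
    (memLp_two_comp_smul h1.1 hc.ne').const_smul (ε ^ (-(d : ℝ) / 2))
  have hρm : MemLp (density (rescale ε φ)) 2 volume := by
    rw [density_rescale hε]
    exact (memLp_two_comp_smul h3 hc.ne').const_smul ((ε ^ d)⁻¹)
  have hVi : Integrable (fun x => harmonicPotential γ x * density (rescale ε φ) x) volume := by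
    rw [density_rescale hε]
    simp_rw [hV]
    exact ((integrable_comp_smul_iff volume
      (fun x => harmonicPotential γ x * density φ x) hc.ne').2 h1.2.2).const_mul _
  refine ⟨⟨⟨hφm, eI, hVi⟩, ⟨hφm, g1⟩, hρm, by rw [density_rescale hε]; exact g2⟩, ?_⟩
  have e1' : ∫ x, gradSq (rescale ε φ) x = (ε ^ 2)⁻¹ * ∫ x, gradSq φ x := by
    refine e1.trans ?_
    rw [rescale_factor_sq hε, hinv]
    field_simp
  have e2' : ∫ x, gradSq (density (rescale ε φ)) x
      = (ε ^ (d + 2))⁻¹ * ∫ x, gradSq (density φ) x := by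
    rw [density_rescale hε, e2, hinv]
    field_simp
    ring
  rw [densityEnergy, densityEnergy, e1', e2', eV, eN]
  field_simp
  ring

/-- Minimality of a ground state, expressed after rescaling. -/
theorem rescaled_energy_le {ε β δ : ℝ} (hε : 0 < ε)
    (hφ : IsNonnegMinimizer (energy (harmonicPotential γ) β δ) (stateSet (harmonicPotential γ)) φ)
    {χ : Space d → ℂ} (hχ : χ ∈ stateSet (harmonicPotential γ)) :
    densityEnergy (harmonicPotential γ) (β * ε ^ (d + 2)) (δ * ε ^ (d + 4))
        (density (rescale ε φ))
      ≤ ε ^ 4 / 2 * (∫ x, gradSq χ x)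
        + densityEnergy (harmonicPotential γ) (β * ε ^ (d + 2)) (δ * ε ^ (d + 4))
          (density χ) := by
  have h1 := (rescale_mem_stateSet hε β δ hφ.1).2
  have hχ' := (rescale_mem_stateSet (inv_pos.2 hε) β δ hχ).1
  have h2 := (rescale_mem_stateSet hε β δ hχ').2
  rw [rescale_rescale_inv hε] at h2
  have h3 := mul_le_mul_of_nonneg_left (isMinOn_iff.1 hφ.2.1 _ hχ') (sq_nonneg ε)
  -- The kinetic energy of the ground state is simply discarded.
  have h4 : 0 ≤ ε ^ 4 / 2 * ∫ x, gradSq (rescale ε φ) x :=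
    mul_nonneg (by positivity) (integral_nonneg (gradSq_nonneg _))
  linarith

end Rescaling

/-! ### Convergence of the rescaled ground states -/

section Limits

variable {d : ℕ} {γ : Fin d → ℝ} {ι : Type*} {l : Filter ι} {β δ ε : ι → ℝ}
  {φ : ι → Space d → ℂ} {b c : ℝ}

/-- Upper bound for the energies of the rescaled ground states. -/
theorem eventually_densityEnergy_le
    (hφ : ∀ i, IsNonnegMinimizer (energy (harmonicPotential γ) (β i) (δ i))
      (stateSet (harmonicPotential γ)) (φ i))
    (hε : ∀ᶠ i in l, 0 < ε i) (hε0 : Tendsto ε l (𝓝 0))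
    (hb : Tendsto (fun i => β i * ε i ^ (d + 2)) l (𝓝 b))
    (hc : Tendsto (fun i => δ i * ε i ^ (d + 4)) l (𝓝 c)) (hb0 : 0 ≤ b) (hc0 : 0 ≤ c)
    {ρ : Space d → ℝ} (hρ : IsTrappedDensity (harmonicPotential γ) ρ) (hρ2 : MemLp ρ 2 volume)
    (hρc : c = 0 ∨ HasL2WeakGrad ρ) {η : ℝ} (hη : 0 < η) :
    ∀ᶠ i in l, densityEnergy (harmonicPotential γ) (β i * ε i ^ (d + 2)) (δ i * ε i ^ (d + 4))
      (density (rescale (ε i) (φ i))) ≤ densityEnergy (harmonicPotential γ) b c ρ + η := by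
  -- The trial state is fixed before the limit, so its kinetic energy, however large, is killed by
  -- `ε⁴`.
  obtain ⟨χ, hχ, h1, h2, h3⟩ := hρ.exists_mem_stateSet (half_pos hη)
  have hle : densityEnergy (harmonicPotential γ) b c (density χ)
      ≤ densityEnergy (harmonicPotential γ) b c ρ + η / 2 := by
    have h4 := mul_le_mul_of_nonneg_left (h2 hρ2) (half_pos (α := ℝ) one_pos |>.le |>
      fun h => mul_nonneg hb0 h)
    have h5 : c / 2 * ∫ x, gradSq (density χ) x ≤ c / 2 * ∫ x, gradSq ρ x := by
      rcases hρc with rfl | hg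
      · simp
      · exact mul_le_mul_of_nonneg_left (h3 hg) (by positivity)
    unfold densityEnergy
    linarith
  have hlim : Tendsto (fun i => ε i ^ 4 / 2 * (∫ x, gradSq χ x)
      + densityEnergy (harmonicPotential γ) (β i * ε i ^ (d + 2)) (δ i * ε i ^ (d + 4))
        (density χ)) l
      (𝓝 (0 ^ 4 / 2 * (∫ x, gradSq χ x) + densityEnergy (harmonicPotential γ) b c (density χ))) :=
    (((hε0.pow 4).div_const 2).mul_const _).add
      (((hb.div_const 2).mul_const _).const_add _ |>.add ((hc.div_const 2).mul_const _))
  have hlt : 0 ^ 4 / 2 * (∫ x, gradSq χ x) + densityEnergy (harmonicPotential γ) b c (density χ)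
      < densityEnergy (harmonicPotential γ) b c ρ + η := by
    rw [zero_pow four_ne_zero, zero_div, zero_mul, zero_add]
    linarith
  filter_upwards [hε, hlim.eventually_le_const hlt] with i hi hi'
  exact (rescaled_energy_le hi (hφ i) hχ).trans hi'

theorem tendsto_zero_of_eventually_le {u : ι → ℝ} (h0 : ∀ i, 0 ≤ u i)
    (h : ∀ ε > 0, ∀ᶠ i in l, u i ≤ ε) : Tendsto u l (𝓝 0) := by
  rw [Metric.tendsto_nhds]
  intro ε hε
  filter_upwards [h (ε / 2) (half_pos hε)] with i hi
  rw [Real.dist_eq, sub_zero, abs_of_nonneg (h0 i)]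
  linarith

theorem density_mem_sobolevDensities {χ : Space d → ℂ} {V : Space d → ℝ} (h : χ ∈ stateSet V) :
    density χ ∈ sobolevDensities V :=
  ⟨h.1.isTrappedDensity, h.2.2.2⟩

/-- Convergence in `H¹` when the gradient term survives in the limit. -/
theorem tendstoInH1_density_rescale (hd : 1 ≤ d)
    (hφ : ∀ i, IsNonnegMinimizer (energy (harmonicPotential γ) (β i) (δ i))
      (stateSet (harmonicPotential γ)) (φ i))
    (hε : ∀ᶠ i in l, 0 < ε i) (hε0 : Tendsto ε l (𝓝 0))
    (hb : Tendsto (fun i => β i * ε i ^ (d + 2)) l (𝓝 b))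
    (hbb : ∀ᶠ i in l, b ≤ β i * ε i ^ (d + 2))
    (hc : Tendsto (fun i => δ i * ε i ^ (d + 4)) l (𝓝 c)) (hb0 : 0 ≤ b) (hc0 : 0 < c)
    {ρ : Space d → ℝ} (hρ : ρ ∈ sobolevDensities (harmonicPotential γ))
    (hmin : ∀ σ ∈ sobolevDensities (harmonicPotential γ),
      densityEnergy (harmonicPotential γ) b c ρ ≤ densityEnergy (harmonicPotential γ) b c σ) :
    TendstoInH1 (fun i => density (rescale (ε i) (φ i))) l ρ := by
  set V := harmonicPotential γ
  have hρ2 := memLp_two_of_mem_sobolevDensities hρ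
  set m := densityEnergy V b c ρ
  have hm0 : 0 ≤ m := densityEnergy_nonneg hb0 hc0.le hρ.1
  have hmem : ∀ᶠ i in l, density (rescale (ε i) (φ i)) ∈ sobolevDensities V := by
    filter_upwards [hε] with i hi
    exact density_mem_sobolevDensities (rescale_mem_stateSet hi (β i) (δ i) (hφ i).1).1
  have hup : ∀ {η : ℝ}, 0 < η → ∀ᶠ i in l, densityEnergy V (β i * ε i ^ (d + 2))
      (δ i * ε i ^ (d + 4)) (density (rescale (ε i) (φ i))) ≤ m + η := fun hη => eventually_densityEnergy_le hφ hε hε0 hb hc hb0 hc0.le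
    hρ.1 hρ2 (Or.inr hρ.2) hη
  -- Passing to the limit coefficients: the error in `b` has a favourable sign by `hbb`, and the
  -- error in `c` tends to `0` once the gradients are bounded.
  have hE : ∀ η > 0, ∀ᶠ i in l, densityEnergy V b c (density (rescale (ε i) (φ i))) ≤ m + η := by
    intro η hη
    have hsmall : Tendsto (fun i => (c - δ i * ε i ^ (d + 4)) / 2 * (4 * (m + 1) / c)) l
        (𝓝 ((c - c) / 2 * (4 * (m + 1) / c))) :=
      (((hc.const_sub c)).div_const 2).mul_const _
    rw [sub_self, zero_div, zero_mul] at hsmall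
    filter_upwards [hmem, hup one_pos, hup (half_pos hη), hbb,
      hc.eventually_const_le (half_lt_self hc0),
      hsmall.eventually_le_const (half_pos hη)] with i h1 h2 h3 h4 h5 h6
    set σ := density (rescale (ε i) (φ i))
    have hN : 0 ≤ ∫ x, σ x ^ 2 := integral_nonneg fun x => sq_nonneg _
    have hD : 0 ≤ ∫ x, gradSq σ x := integral_nonneg (gradSq_nonneg _)
    -- Eventually the gradient coefficient is at least `c/2` and the energy at most `m + 1`, while
    -- the other terms are nonnegative, so `(c/4)∫|∇σ|² ≤ m + 1`.
    have hD' : ∫ x, gradSq σ x ≤ 4 * (m + 1) / c := by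
      have h7 := densityEnergy_nonneg (b := β i * ε i ^ (d + 2)) (c := 0) (hb0.trans h4) le_rfl h1.1
      rw [le_div_iff₀ hc0]
      simp only [densityEnergy] at h2 h7
      nlinarith
    have h8 := mul_le_mul_of_nonneg_right h4 hN
    have h9 : (c - δ i * ε i ^ (d + 4)) / 2 * ∫ x, gradSq σ x ≤ η / 2 := by
      rcases le_total (c - δ i * ε i ^ (d + 4)) 0 with h | h
      · have := mul_nonpos_of_nonpos_of_nonneg h hD
        linarith
      · exact (mul_le_mul_of_nonneg_left hD' (by positivity)).trans h6
    simp only [densityEnergy] at h3 ⊢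
    linarith
  have hclose : ∀ κ > 0, ∀ᶠ i in l, ∫ x, (density (rescale (ε i) (φ i)) x - ρ x) ^ 2 ≤ κ ∧
      ∫ x, gradSq (density (rescale (ε i) (φ i)) - ρ) x ≤ κ := by
    intro κ hκ
    obtain ⟨η, hη, h⟩ := near_minimizers_close (V := V) hd hb0 hc0 hκ
    filter_upwards [hmem, hE η hη] with i h1 h2
    exact h m hmin _ h1 ρ hρ h2 (by linarith)
  refine ⟨?_, ⟨hρ2, hρ.2⟩, ?_, fun k => ?_⟩
  · filter_upwards [hmem] with i hi using ⟨memLp_two_of_mem_sobolevDensities hi, hi.2⟩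
  · refine tendsto_eLpNorm_two ?_ hρ2 ?_
    · filter_upwards [hmem] with i hi using memLp_two_of_mem_sobolevDensities hi
    · exact tendsto_zero_of_eventually_le (fun i => integral_nonneg fun x => sq_nonneg _)
        fun κ hκ => (hclose κ hκ).mono fun i hi => hi.1
  · refine tendsto_eLpNorm_two ?_ (hρ.2.memLp k) ?_
    · filter_upwards [hmem] with i hi using hi.2.memLp k
    · refine tendsto_zero_of_eventually_le (fun i => integral_nonneg fun x => sq_nonneg _)
        fun κ hκ => ?_
      filter_upwards [hclose κ hκ, hmem] with i hi hi'
      refine le_trans ?_ hi.2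
      rw [integral_gradSq_sub hi'.2 hρ.2]
      exact Finset.single_le_sum (f := fun j => ∫ x, (weakPartial j
        (density (rescale (ε i) (φ i))) x - weakPartial j ρ x) ^ 2)
        (fun j _ => integral_nonneg fun x => sq_nonneg _) (Finset.mem_univ k)

/-- Convergence in `L²` to the Thomas–Fermi profile when the gradient term vanishes. -/
theorem tendstoInL2_density_rescale (hγ : ∀ i, 0 < γ i)
    (hφ : ∀ i, IsNonnegMinimizer (energy (harmonicPotential γ) (β i) (δ i))
      (stateSet (harmonicPotential γ)) (φ i))
    (hε : ∀ᶠ i in l, 0 < ε i) (hε0 : Tendsto ε l (𝓝 0))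
    (hb : ∀ᶠ i in l, β i * ε i ^ (d + 2) = 1) (hδ : ∀ i, 0 < δ i)
    (hc : Tendsto (fun i => δ i * ε i ^ (d + 4)) l (𝓝 0))
    {μ : ℝ} (hμ : ∫ x, thomasFermi γ μ x = 1) :
    TendstoInL2 (fun i => density (rescale (ε i) (φ i))) l (thomasFermi γ μ) := by
  have hmem : ∀ᶠ i in l, rescale (ε i) (φ i) ∈ stateSet (harmonicPotential γ) := by
    filter_upwards [hε] with i hi
    exact (rescale_mem_stateSet hi (β i) (δ i) (hφ i).1).1
  have hb' : Tendsto (fun i => β i * ε i ^ (d + 2)) l (𝓝 1) :=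
    tendsto_const_nhds.congr' (hb.mono fun i hi => hi.symm)
  have hmem2 : ∀ᶠ i in l, MemLp (density (rescale (ε i) (φ i))) 2 volume :=
    hmem.mono fun i hi => hi.2.2.1
  refine ⟨hmem2, memLp_thomasFermi hγ μ, tendsto_eLpNorm_two hmem2 (memLp_thomasFermi hγ μ) ?_⟩
  refine tendsto_zero_of_eventually_le (fun i => integral_nonneg fun x => sq_nonneg _)
    fun κ hκ => ?_
  filter_upwards [hmem, hε, hb, eventually_densityEnergy_le hφ hε hε0 hb' hc zero_le_one le_rfl
    (isTrappedDensity_thomasFermi hγ hμ) (memLp_thomasFermi hγ μ) (Or.inl rfl)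
    (half_pos hκ)] with i h1 h2 h3 h4
  have h5 := densityEnergy_thomasFermi_add_le hγ hμ h1.1.isTrappedDensity h1.2.2.1
  -- No bound on the gradient is available or needed: the term is nonnegative and is dropped, and
  -- the Thomas–Fermi lower bound controls the distance.
  have h6 : 0 ≤ δ i * ε i ^ (d + 4) / 2 * ∫ x, gradSq (density (rescale (ε i) (φ i))) x :=
    mul_nonneg (by have := hδ i; positivity) (integral_nonneg (gradSq_nonneg _))
  rw [h3] at h4
  simp only [densityEnergy] at h4 h5
  linarith

end Limits

/-! ### Unique minimizers of the limit functionals -/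

section Minimizers

variable {d : ℕ} {γ : Fin d → ℝ} {b c : ℝ}

theorem IsTrappedDensity.congr {V ρ σ : Space d → ℝ} (h : IsTrappedDensity V ρ)
    (hρσ : ρ =ᵐ[volume] σ) : IsTrappedDensity V σ := by
  refine ⟨h.integrable.congr hρσ, ?_, ?_, h.integrable_mul.congr ?_⟩
  · filter_upwards [h.nonneg, hρσ] with x hx hx'
    rwa [← hx']
  · rw [← integral_congr_ae hρσ, h.integral_eq_one]
  · filter_upwards [hρσ] with x hx
    rw [hx]

theorem densityEnergy_congr_ae {V ρ σ : Space d → ℝ} (h : HasL2WeakGrad ρ)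
    (hρσ : ρ =ᵐ[volume] σ) : densityEnergy V b c σ = densityEnergy V b c ρ := by
  have h1 : ∫ x, V x * σ x = ∫ x, V x * ρ x := integral_congr_ae <| by
    filter_upwards [hρσ] with x hx
    rw [hx]
  have h2 : ∫ x, σ x ^ 2 = ∫ x, ρ x ^ 2 := integral_congr_ae <| by
    filter_upwards [hρσ] with x hx
    rw [hx]
  rw [densityEnergy, densityEnergy, h1, h2, integral_congr_ae (gradSq_congr_ae h hρσ)]

/-- Reduces existence and uniqueness for states to the same questions for densities. -/
theorem isUniqueNonnegMinimizer_sqrtState {E : (Space d → ℂ) → ℝ} {S : Set (Space d → ℂ)}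
    {ρ : Space d → ℝ} (hS : sqrtState ρ ∈ S) (hE : ∀ ψ ∈ S, E (sqrtState ρ) ≤ E ψ)
    (hu : ∀ ψ ∈ S, E ψ ≤ E (sqrtState ρ) → density ψ =ᵐ[volume] ρ) :
    IsUniqueNonnegMinimizer E S (sqrtState ρ) := by
  refine ⟨⟨hS, isMinOn_iff.2 hE, Eventually.of_forall fun x => ?_⟩, fun ψ hψ => ?_⟩
  · simp [sqrtState, Real.sqrt_nonneg]
  · filter_upwards [hu ψ hψ.1 (isMinOn_iff.1 hψ.2.1 _ hS), hψ.2.2] with x hx hx'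
    rw [eq_sqrtState_density hx', sqrtState, sqrtState, hx]

theorem ae_eq_of_integral_sq_sub_le {ρ σ : Space d → ℝ} (hρ : MemLp ρ 2 volume)
    (hσ : MemLp σ 2 volume) (h : ∀ ε > 0, ∫ x, (ρ x - σ x) ^ 2 ≤ ε) : ρ =ᵐ[volume] σ := by
  have h0 : ∫ x, (ρ x - σ x) ^ 2 = 0 :=
    le_antisymm (le_of_forall_pos_le_add fun ε hε => by simpa using h ε hε)
      (integral_nonneg fun x => sq_nonneg _)
  have hi : Integrable (fun x => (ρ x - σ x) ^ 2) volume := (hρ.sub hσ).integrable_sq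
  rw [integral_eq_zero_iff_of_nonneg (fun x => sq_nonneg _) hi] at h0
  filter_upwards [h0] with x hx
  exact sub_eq_zero.1 (pow_eq_zero_iff two_ne_zero |>.1 hx)

/-- Unique minimizers of the limit functionals with a gradient term. -/
theorem exists_isUniqueNonnegMinimizer (hd : 1 ≤ d) (hγ : ∀ i, 0 < γ i) (hb : 0 ≤ b) (hc : 0 < c)
    {E : (Space d → ℂ) → ℝ} {S : Set (Space d → ℂ)}
    (hS : ∀ ψ, ψ ∈ S ↔ IsTrappedState (harmonicPotential γ) ψ ∧ HasL2WeakGrad (density ψ))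
    (hE : ∀ ψ ∈ S, E ψ = densityEnergy (harmonicPotential γ) b c (density ψ)) :
    ∃ φ, IsUniqueNonnegMinimizer E S φ ∧ density φ ∈ sobolevDensities (harmonicPotential γ) ∧
      ∀ σ ∈ sobolevDensities (harmonicPotential γ),
        densityEnergy (harmonicPotential γ) b c (density φ)
          ≤ densityEnergy (harmonicPotential γ) b c σ := by
  obtain ⟨ρ, hρ, hmin⟩ := exists_minimizer hd hγ hb hc
  have hae := density_sqrtState_ae hρ.1.nonneg
  have hφ : density (sqrtState ρ) ∈ sobolevDensities (harmonicPotential γ) :=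
    ⟨hρ.1.congr hae.symm, hρ.2.congr hae.symm⟩
  have hφS : sqrtState ρ ∈ S := (hS _).2 ⟨hρ.1.isTrappedState, hφ.2⟩
  have hEφ := densityEnergy_congr_ae (V := harmonicPotential γ) (b := b) (c := c) hρ.2 hae.symm
  have hsob : ∀ ψ ∈ S, density ψ ∈ sobolevDensities (harmonicPotential γ) := fun ψ hψ =>
    ⟨((hS ψ).1 hψ).1.isTrappedDensity, ((hS ψ).1 hψ).2⟩
  refine ⟨sqrtState ρ, isUniqueNonnegMinimizer_sqrtState hφS (fun ψ hψ => ?_) fun ψ hψ hle => ?_,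
    hφ, fun σ hσ => hEφ.trans_le (hmin σ hσ)⟩
  · rw [hE _ hφS, hE _ hψ, hEφ]
    exact hmin _ (hsob ψ hψ)
  · rw [hE _ hφS, hE _ hψ, hEφ] at hle
    refine ae_eq_of_integral_sq_sub_le (memLp_two_of_mem_sobolevDensities (hsob ψ hψ))
      (memLp_two_of_mem_sobolevDensities hρ) fun ε hε => ?_
    obtain ⟨η, hη, h⟩ := near_minimizers_close (V := harmonicPotential γ) hd hb hc hε
    -- Exact minimizers are within every `η` of the minimum, hence at `L²` distance zero.
    exact (h _ hmin _ (hsob ψ hψ) ρ hρ (by linarith) (by linarith)).1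

theorem energy₁_eq {V : Space d → ℝ} {φ : Space d → ℂ} (hφ : φ ∈ stateSet₁ V) :
    energy₁ V φ = densityEnergy V 1 0 (density φ) := by
  rw [energy₁, integral_add hφ.1.2.2 (hφ.2.integrable_sq.const_mul _), integral_const_mul,
    densityEnergy]
  simp

theorem energy₂_eq {V : Space d → ℝ} {φ : Space d → ℂ} (δ : ℝ) (hφ : φ ∈ stateSet₂ V) :
    energy₂ V δ φ = densityEnergy V 1 δ (density φ) := by
  obtain ⟨h1, h2, h3⟩ := hφ
  have i1 : Integrable (fun x => V x * density φ x + (1 / 2) * density φ x ^ 2) volume :=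
    h1.2.2.add (h2.integrable_sq.const_mul _)
  rw [energy₂, integral_add i1 (h3.integrable_gradSq.const_mul _),
    integral_add h1.2.2 (h2.integrable_sq.const_mul _), integral_const_mul, integral_const_mul,
    densityEnergy]

theorem energy₃_eq {V : Space d → ℝ} {φ : Space d → ℂ} (hφ : φ ∈ stateSet₃ V) :
    energy₃ V φ = densityEnergy V 0 1 (density φ) := by
  rw [energy₃, integral_add hφ.1.2.2 (hφ.2.integrable_gradSq.const_mul _), integral_const_mul,
    densityEnergy]
  simp

/-- Square integrability of the density is automatic by the Nash inequality, so `E₂` and `E₃` have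
the same domain. -/
theorem mem_stateSet₂_iff {V : Space d → ℝ} {φ : Space d → ℂ} :
    φ ∈ stateSet₂ V ↔ IsTrappedState V φ ∧ HasL2WeakGrad (density φ) :=
  ⟨fun h => ⟨h.1, h.2.2⟩, fun h =>
    ⟨h.1, memLp_two_of_mem_sobolevDensities ⟨h.1.isTrappedDensity, h.2⟩, h.2⟩⟩

end Minimizers

/-! ### Powers of the scaling parameter -/

section Scales

variable {d : ℕ} {ι : Type*} {l : Filter ι} {β δ : ι → ℝ}

theorem rpow_neg_one_div_pow {x : ℝ} (hx : 0 < x) (a : ℝ) (n : ℕ) :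
    (x ^ (-(1 : ℝ) / a)) ^ n = (x ^ ((n : ℝ) / a))⁻¹ := by
  rw [← Real.rpow_natCast, ← Real.rpow_mul hx.le, ← Real.rpow_neg hx.le]
  congr 1
  ring

theorem mul_interaction_scale_pow {x : ℝ} (hx : 0 < x) (n : ℕ) (hn : n ≠ 0) {a : ℝ} (ha : a = n) :
    x * (x ^ (-(1 : ℝ) / a)) ^ n = 1 := by
  have hn' : (n : ℝ) ≠ 0 := Nat.cast_ne_zero.2 hn
  rw [rpow_neg_one_div_pow hx, ha, div_self hn', Real.rpow_one, mul_inv_cancel₀ hx.ne']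

theorem tendsto_scale_zero {x : ι → ℝ} (hx : Tendsto x l atTop) {a : ℝ} (ha : 0 < a) :
    Tendsto (fun i => x i ^ (-(1 : ℝ) / a)) l (𝓝 0) := by
  have := (tendsto_rpow_neg_atTop (one_div_pos.2 ha)).comp hx
  simpa only [Function.comp_def, neg_div] using this

end Scales

end BEC

/-! ### The three limiting regimes -/

open BEC
theorem mainTheorem2 {d : ℕ} (hd1 : 1 ≤ d) (hd3 : d ≤ 3)
    (γ : Fin d → ℝ) (hγ : ∀ i, 0 < γ i)
    {ι : Type*} (l : Filter ι) (β δ : ι → ℝ)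
    (hβ : Tendsto β l atTop) (hδ : ∀ i, 0 < δ i)
    (φg : ι → Space d → ℂ)
    (hφg : ∀ i, IsNonnegMinimizer (energy (harmonicPotential γ) (β i) (δ i))
      (stateSet (harmonicPotential γ)) (φg i)) :
    -- Case 1
    (∃ φinf : Space d → ℂ,
      IsUniqueNonnegMinimizer (energy₁ (harmonicPotential γ)) (stateSet₁ (harmonicPotential γ)) φinf ∧
      (∃ μ : ℝ, μ = energy₁ (harmonicPotential γ) φinf + (1 / 2) * ∫ x, density φinf x ^ 2 ∧
        density φinf =ᵐ[volume] fun x => max (μ - harmonicPotential γ x) 0) ∧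
      (Tendsto (fun i => δ i / β i ^ ((4 + d : ℝ) / (2 + d))) l (𝓝 0) →
        TendstoInL2 (fun i => density (rescale (β i ^ (-(1 : ℝ) / (2 + d))) (φg i))) l
          (density φinf))) ∧
    -- Case 2
    (∀ δinf : ℝ, 0 < δinf → ∃ φinf : Space d → ℂ,
      IsUniqueNonnegMinimizer (energy₂ (harmonicPotential γ) δinf) (stateSet₂ (harmonicPotential γ)) φinf ∧
      (Tendsto (fun i => δ i / β i ^ ((4 + d : ℝ) / (2 + d))) l (𝓝 δinf) →
        TendstoInH1 (fun i => density (rescale (β i ^ (-(1 : ℝ) / (2 + d))) (φg i))) l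
          (density φinf))) ∧
    -- Case 3
    (∃ φinf : Space d → ℂ,
      IsUniqueNonnegMinimizer (energy₃ (harmonicPotential γ)) (stateSet₃ (harmonicPotential γ)) φinf ∧
      (Tendsto (fun i => δ i / β i ^ ((4 + d : ℝ) / (2 + d))) l atTop →
        TendstoInH1 (fun i => density (rescale (δ i ^ (-(1 : ℝ) / (4 + d))) (φg i))) l
          (density φinf))) := by
  have hβ0 : ∀ᶠ i in l, 0 < β i := hβ.eventually_gt_atTop 0
  have hd2 : (0 : ℝ) < 2 + d := by positivity
  have hd4 : (0 : ℝ) < 4 + d := by positivity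
  have hε : ∀ᶠ i in l, 0 < β i ^ (-(1 : ℝ) / (2 + d)) :=
    hβ0.mono fun i hi => Real.rpow_pos_of_pos hi _
  have hε0 : Tendsto (fun i => β i ^ (-(1 : ℝ) / (2 + d))) l (𝓝 0) := tendsto_scale_zero hβ hd2
  have hb1 : ∀ᶠ i in l, β i * (β i ^ (-(1 : ℝ) / (2 + d))) ^ (d + 2) = 1 :=
    hβ0.mono fun i hi => mul_interaction_scale_pow hi (d + 2) (by omega) (by push_cast; ring)
  -- With `ε = β^(-1/(2+d))` the ratio in the hypotheses is exactly the rescaled gradient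
  -- coefficient.
  have hc1 : (fun i => δ i / β i ^ ((4 + d : ℝ) / (2 + d)))
      =ᶠ[l] fun i => δ i * (β i ^ (-(1 : ℝ) / (2 + d))) ^ (d + 4) := by
    filter_upwards [hβ0] with i hi
    rw [rpow_neg_one_div_pow hi, div_eq_mul_inv]
    push_cast
    rw [add_comm (4 : ℝ)]
  refine ⟨?_, fun δinf hδinf => ?_, ?_⟩
  · obtain ⟨μ, hμ⟩ := exists_integral_thomasFermi_eq_one hγ
    have htr := isTrappedDensity_thomasFermi hγ hμ
    have hm := memLp_thomasFermi hγ μ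
    have hden : density (sqrtState (thomasFermi γ μ)) = thomasFermi γ μ :=
      funext fun x => density_sqrtState (thomasFermi_nonneg γ μ x)
    have hS : sqrtState (thomasFermi γ μ) ∈ stateSet₁ (harmonicPotential γ) :=
      ⟨htr.isTrappedState, by rwa [hden]⟩
    refine ⟨sqrtState (thomasFermi γ μ), isUniqueNonnegMinimizer_sqrtState hS
      (fun ψ hψ => ?_) (fun ψ hψ hle => ?_), ⟨μ, ?_, ?_⟩, fun h => ?_⟩
    · have h1 := densityEnergy_thomasFermi_add_le hγ hμ hψ.1.isTrappedDensity hψ.2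
      have h2 : 0 ≤ ∫ x, (density ψ x - thomasFermi γ μ x) ^ 2 :=
        integral_nonneg fun x => sq_nonneg _
      rw [energy₁_eq hS, energy₁_eq hψ, hden]
      linarith
    · have h1 := densityEnergy_thomasFermi_add_le hγ hμ hψ.1.isTrappedDensity hψ.2
      rw [energy₁_eq hS, energy₁_eq hψ, hden] at hle
      exact ae_eq_of_integral_sq_sub_le hψ.2 hm fun ε hε => by linarith
    · rw [energy₁_eq hS, hden]
      exact thomasFermi_chemical_potential hγ hμ
    · rw [hden]
      rfl
    · rw [hden]
      exact tendstoInL2_density_rescale hγ hφg hε hε0 hb1 hδ (h.congr' hc1) hμ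
  · obtain ⟨φ, hφ, hsob, hmin⟩ := exists_isUniqueNonnegMinimizer hd1 hγ zero_le_one hδinf
      (fun ψ => mem_stateSet₂_iff) (fun ψ hψ => energy₂_eq δinf hψ)
    exact ⟨φ, hφ, fun h => tendstoInH1_density_rescale hd1 hφg hε hε0
      (tendsto_const_nhds.congr' (hb1.mono fun i hi => hi.symm))
      (hb1.mono fun i hi => hi.ge) (h.congr' hc1) zero_le_one hδinf hsob hmin⟩
  · obtain ⟨φ, hφ, hsob, hmin⟩ := exists_isUniqueNonnegMinimizer hd1 hγ le_rfl one_pos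
      (fun ψ => Iff.rfl) (fun ψ hψ => energy₃_eq (V := harmonicPotential γ) hψ)
    refine ⟨φ, hφ, fun h => ?_⟩
    -- `δ` is the product of the ratio and a positive power of `β`, both tending to infinity; hence
    -- `ε = δ^(-1/(4+d))` tends to `0`.
    have hδ' : Tendsto δ l atTop := by
      have h1 := h.atTop_mul_atTop₀ ((tendsto_rpow_atTop (div_pos hd4 hd2)).comp hβ)
      refine h1.congr' ?_
      filter_upwards [hβ0] with i hi
      exact div_mul_cancel₀ _ (Real.rpow_pos_of_pos hi _).ne'
    have hc3 : ∀ i, δ i * (δ i ^ (-(1 : ℝ) / (4 + d))) ^ (d + 4) = 1 := fun i =>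
      mul_interaction_scale_pow (hδ i) (d + 4) (by omega) (by push_cast; ring)
    -- At this scale the interaction coefficient is a negative power of the ratio, so it vanishes in
    -- the limit and `b = 0`, `c = 1`.
    have hb3 : (fun i => (δ i / β i ^ ((4 + d : ℝ) / (2 + d))) ^ (-((2 + d : ℝ) / (4 + d))))
        =ᶠ[l] fun i => β i * (δ i ^ (-(1 : ℝ) / (4 + d))) ^ (d + 2) := by
      filter_upwards [hβ0] with i hi
      rw [rpow_neg_one_div_pow (hδ i), Real.div_rpow (hδ i).le (Real.rpow_nonneg hi.le _),
        ← Real.rpow_mul hi.le, Real.rpow_neg (hδ i).le,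
        show (4 + d : ℝ) / (2 + d) * -((2 + d) / (4 + d)) = -1 by field_simp,
        Real.rpow_neg_one, div_inv_eq_mul, mul_comm]
      push_cast
      rw [add_comm (2 : ℝ)]
    have hb0 : Tendsto (fun i => β i * (δ i ^ (-(1 : ℝ) / (4 + d))) ^ (d + 2)) l (𝓝 0) :=
      ((tendsto_rpow_neg_atTop (div_pos hd2 hd4)).comp h).congr' hb3
    refine tendstoInH1_density_rescale hd1 hφg
      (Eventually.of_forall fun i => Real.rpow_pos_of_pos (hδ i) _) (tendsto_scale_zero hδ' hd4)
      hb0 (hβ0.mono fun i hi => ?_) ?_ le_rfl one_pos hsob hmin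
    · have := hδ i
      positivity
    · simp only [hc3]
      exact tendsto_const_nhds
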